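/- Let $d\in\{2,3\}$, let $D\subset\mathbb R^d$ be a bounded domain with $C^2$ boundary, let $Y=[0,1]^d$, and let $a\in L^\infty(\mathbb R^d)$ be real valued and $Y$-periodic with $a\ge a_0$ almost everywhere for a constant $a_0>0$. Let $\tau>0$. Write $\overline{f}=\frac1{|Y|}\int_Y f\,dy$ for the cell average, and let $\chi\in H^2_\sharp(Y)$ (the $Y$-periodic functions in $H^2_{\rm loc}(\mathbb R^d)$) be the cell function, given by $$\Delta_y\chi=\frac{\overline{a^{-1}}^{\,-1}}{a}-1,\qquad \overline{\chi}=0 .$$ Let $H^2_0(D)$ be the closure of $C_c^\infty(D)$ in $H^2(D)$, with norm $\|u\|_{H^2_0(D)}=\|\Delta u\|_{L^2(D)}$, and let $H^{-2}(D)$ be its dual. Then there is a constant $C>0$, which depends only on $d$, $D$, $a$ and $\tau$, such that the following holds for all $0<\epsilon\le 1$ and all $h\in H^{-2}(D)$. Let $u_\epsilon,u_0\in H^2_0(D)$ be the variational solutions of $$(\Delta+\tau)\,a(x/\epsilon)\,(\Delta+\tau)u_\epsilon+\tau^2u_\epsilon=h,\qquad (\Delta+\tau)\,\overline{a^{-1}}^{\,-1}(\Delta+\tau)u_0+\tau^2u_0=h\qquad\text{in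 }D,$$ and suppose that $u_0\in H^4(D)$. Put $u^{(2)}(x)=\chi(x/\epsilon)\,(\Delta+\tau)u_0(x)$, and let the boundary corrector $\theta^{(2)}_\epsilon\in H^2(D)$ be the variational solution of $$(\Delta+\tau)\,a(x/\epsilon)\,(\Delta+\tau)\theta^{(2)}_\epsilon+\tau^2\theta^{(2)}_\epsilon=0\ \text{ in }D,\qquad \theta^{(2)}_\epsilon=-\epsilon u^{(2)},\quad \frac{\partial\theta^{(2)}_\epsilon}{\partial\nu}=-\epsilon\frac{\partial u^{(2)}}{\partial\nu}\ \text{ on }\partial D,$$ where the boundary conditions mean that $\theta^{(2)}_\epsilon+\epsilon u^{(2)}\in H^2_0(D)$. Then $u_\epsilon-(u_0+\epsilon^2u^{(2)}+\epsilon\theta^{(2)}_\epsilon)\in H^2_0(D)$ and $$\bigl\|u_\epsilon-(u_0+\epsilon^2u^{(2)}+\epsilon\theta^{(2)}_\epsilon)\bigr\|_{H^2_0(D)}\le C\,\epsilon\,\|u_0\|_{H^4(D)} .$$ -/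

import Mathlib

open MeasureTheory Set
open scoped ContDiff

noncomputable section

/-- A bounded domain (nonempty, open, connected) of `ℝ^d` with `C^2` boundary: near each boundary
point the domain is the sublevel set of a `C^2` function with nonvanishing gradient there. -/
structure IsC2Domain {d : ℕ} (D : Set (EuclideanSpace ℝ (Fin d))) : Prop where
  isOpen : IsOpen D
  isConnected : IsConnected D
  isBounded : Bornology.IsBounded D
  boundary : ∀ x ∈ frontier D, ∃ r : ℝ, 0 < r ∧ ∃ g : EuclideanSpace ℝ (Fin d) → ℝ,
    ContDiff ℝ 2 g ∧ fderiv ℝ g x ≠ 0 ∧ ∀ y ∈ Metric.ball x r, (y ∈ D ↔ g y < 0)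

/-- `φ ∈ C_c^∞(D)`. -/
structure IsTestFunction {d : ℕ} (D : Set (EuclideanSpace ℝ (Fin d)))
    (φ : EuclideanSpace ℝ (Fin d) → ℝ) : Prop where
  contDiff : ContDiff ℝ ∞ φ
  hasCompactSupport : HasCompactSupport φ
  tsupport_subset : tsupport φ ⊆ D

/-- The classical partial derivative `∂_{i 0} ∂_{i 1} ⋯ ∂_{i (k-1)} φ`. -/
def partialDeriv {d k : ℕ} (i : Fin k → Fin d) (φ : EuclideanSpace ℝ (Fin d) → ℝ)
    (x : EuclideanSpace ℝ (Fin d)) : ℝ :=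
  iteratedFDeriv ℝ k φ x (fun j => EuclideanSpace.single (i j) (1 : ℝ))

/-- `w` is the weak partial derivative `∂_{i 0} ⋯ ∂_{i (k-1)} u` in the open set `D`. -/
structure IsWeakDeriv {d k : ℕ} (D : Set (EuclideanSpace ℝ (Fin d))) (i : Fin k → Fin d)
    (u w : EuclideanSpace ℝ (Fin d) → ℝ) : Prop where
  locallyIntegrableOn : LocallyIntegrableOn u D volume
  locallyIntegrableOn_deriv : LocallyIntegrableOn w D volume
  integral_eq : ∀ φ : EuclideanSpace ℝ (Fin d) → ℝ, IsTestFunction D φ →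
    ∫ x in D, u x * partialDeriv i φ x = (-1) ^ k * ∫ x in D, w x * φ x

open Classical in
/-- A representative of the weak partial derivative of `u` in `D` (which is unique up to null sets),
and `0` if there is none. -/
def weakDeriv {d k : ℕ} (D : Set (EuclideanSpace ℝ (Fin d))) (i : Fin k → Fin d)
    (u : EuclideanSpace ℝ (Fin d) → ℝ) : EuclideanSpace ℝ (Fin d) → ℝ :=
  if h : ∃ w, IsWeakDeriv D i u w then h.choose else 0

/-- The weak Laplacian `Δu = ∑ i, ∂_i ∂_i u` in `D`. -/
def weakLaplacian {d : ℕ} (D : Set (EuclideanSpace ℝ (Fin d)))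
    (u : EuclideanSpace ℝ (Fin d) → ℝ) (x : EuclideanSpace ℝ (Fin d)) : ℝ :=
  ∑ i : Fin d, weakDeriv D ![i, i] u x

/-- `u ∈ H^m(D)`. -/
def MemSobolev {d : ℕ} (m : ℕ) (D : Set (EuclideanSpace ℝ (Fin d)))
    (u : EuclideanSpace ℝ (Fin d) → ℝ) : Prop :=
  MemLp u 2 (volume.restrict D) ∧ ∀ k ≤ m, ∀ i : Fin k → Fin d,
    ∃ w, IsWeakDeriv D i u w ∧ MemLp w 2 (volume.restrict D)

/-- The norm of `H^m(D)`: the square root of `∑_{k ≤ m} ∫_D |D^k u|²`, with the Frobenius norm of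
the tensor `D^k u` of all `k`-th order partial derivatives. -/
def sobolevNorm {d : ℕ} (m : ℕ) (D : Set (EuclideanSpace ℝ (Fin d)))
    (u : EuclideanSpace ℝ (Fin d) → ℝ) : ℝ :=
  Real.sqrt (∑ k ∈ Finset.range (m + 1), ∑ i : Fin k → Fin d, ∫ x in D, weakDeriv D i u x ^ 2)

/-- `u ∈ H^2_0(D)`, the closure of `C_c^∞(D)` in `H^2(D)`. -/
def MemH20 {d : ℕ} (D : Set (EuclideanSpace ℝ (Fin d)))
    (u : EuclideanSpace ℝ (Fin d) → ℝ) : Prop :=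
  MemSobolev 2 D u ∧ ∀ δ : ℝ, 0 < δ → ∃ φ, IsTestFunction D φ ∧
    sobolevNorm 2 D (fun x => u x - φ x) < δ

/-- The norm `‖Δu‖_{L²(D)}` of `H^2_0(D)`, that is, the norm of its inner product
`(u, v) = (Δu, Δv)_{L²(D)}`. -/
def normH20 {d : ℕ} (D : Set (EuclideanSpace ℝ (Fin d)))
    (u : EuclideanSpace ℝ (Fin d) → ℝ) : ℝ :=
  Real.sqrt (∫ x in D, weakLaplacian D u x ^ 2)

/-- `h ∈ H^{-2}(D)`, the dual of `H^2_0(D)`. Only the values of `h` on `H^2_0(D)` matter, and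
the bound forces them to depend only on the class of the argument modulo null sets. -/
structure MemHNegTwo {d : ℕ} (D : Set (EuclideanSpace ℝ (Fin d)))
    (h : (EuclideanSpace ℝ (Fin d) → ℝ) → ℝ) : Prop where
  map_add : ∀ φ ψ, MemH20 D φ → MemH20 D ψ → h (fun x => φ x + ψ x) = h φ + h ψ
  map_smul : ∀ (c : ℝ) φ, MemH20 D φ → h (fun x => c * φ x) = c * h φ
  bound : ∃ K : ℝ, ∀ φ, MemH20 D φ → |h φ| ≤ K * normH20 D φ

/-- The bilinear form `(b (Δ + τ) u, (Δ + τ) φ)_{L²(D)} + τ² (u, φ)_{L²(D)}` of the operator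
`(Δ + τ) b (Δ + τ) + τ²`. -/
def fourthOrderForm {d : ℕ} (D : Set (EuclideanSpace ℝ (Fin d)))
    (b : EuclideanSpace ℝ (Fin d) → ℝ) (τ : ℝ) (u φ : EuclideanSpace ℝ (Fin d) → ℝ) : ℝ :=
  (∫ x in D, b x * (weakLaplacian D u x + τ * u x) * (weakLaplacian D φ x + τ * φ x))
    + τ ^ 2 * ∫ x in D, u x * φ x

/-- `u ∈ H^2_0(D)` is the variational solution of `(Δ + τ) b (Δ + τ) u + τ² u = h` in `D`. -/
def IsH20Solution {d : ℕ} (D : Set (EuclideanSpace ℝ (Fin d)))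
    (b : EuclideanSpace ℝ (Fin d) → ℝ) (τ : ℝ) (h : (EuclideanSpace ℝ (Fin d) → ℝ) → ℝ)
    (u : EuclideanSpace ℝ (Fin d) → ℝ) : Prop :=
  MemH20 D u ∧ ∀ φ, MemH20 D φ → fourthOrderForm D b τ u φ = h φ

/-- Periodicity with respect to `ℤ^d`, that is, with period cell `Y = [0,1]^d`. -/
def IsCellPeriodic {d : ℕ} (f : EuclideanSpace ℝ (Fin d) → ℝ) : Prop :=
  ∀ i : Fin d, ∀ᵐ y, f (y + EuclideanSpace.single i (1 : ℝ)) = f y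

/-- The period cell `Y = [0,1]^d`. -/
def periodCell (d : ℕ) : Set (EuclideanSpace ℝ (Fin d)) :=
  {y | ∀ i : Fin d, y i ∈ Icc (0 : ℝ) 1}

/-- The homogenized coefficient: the inverse of the cell average of `a⁻¹`. -/
def homogenizedCoeff {d : ℕ} (a : EuclideanSpace ℝ (Fin d) → ℝ) : ℝ :=
  (⨍ y in periodCell d, (a y)⁻¹)⁻¹

/-- `χ ∈ H^2_♯(Y)`: periodic and in `H^2` of bounded sets (in particular across the faces of the
period cell). -/
def MemPeriodicH2 {d : ℕ} (χ : EuclideanSpace ℝ (Fin d) → ℝ) : Prop :=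
  IsCellPeriodic χ ∧ ∀ k ≤ 2, ∀ i : Fin k → Fin d, ∃ w, IsWeakDeriv univ i χ w ∧
    ∀ R : ℝ, MemLp w 2 (volume.restrict (Metric.ball 0 R))

/-- The cell function: the `Y`-periodic `χ` with zero cell average and
`Δχ = (average of a⁻¹)⁻¹ / a - 1`. -/
structure IsCellFunction {d : ℕ} (a χ : EuclideanSpace ℝ (Fin d) → ℝ) : Prop where
  memPeriodicH2 : MemPeriodicH2 χ
  laplacian_eq : ∀ᵐ y, weakLaplacian univ χ y = homogenizedCoeff a / a y - 1
  average_eq_zero : ⨍ y in periodCell d, χ y = 0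

/-- The bulk corrector `u⁽²⁾(x) = χ(x/ε) (Δ + τ) u₀(x)`. -/
def bulkCorrector {d : ℕ} (D : Set (EuclideanSpace ℝ (Fin d)))
    (χ : EuclideanSpace ℝ (Fin d) → ℝ) (τ ε : ℝ) (u₀ : EuclideanSpace ℝ (Fin d) → ℝ)
    (x : EuclideanSpace ℝ (Fin d)) : ℝ :=
  χ (ε⁻¹ • x) * (weakLaplacian D u₀ x + τ * u₀ x)

/-- `θ ∈ H^2(D)` is the variational solution of `(Δ + τ) b (Δ + τ) θ + τ² θ = 0` in `D` with
`θ = g` and `∂θ/∂ν = ∂g/∂ν` on `∂D`, the boundary conditions being read as `θ - g ∈ H^2_0(D)`. -/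
structure IsDirichletSolution {d : ℕ} (D : Set (EuclideanSpace ℝ (Fin d)))
    (b : EuclideanSpace ℝ (Fin d) → ℝ) (τ : ℝ) (g θ : EuclideanSpace ℝ (Fin d) → ℝ) : Prop where
  memSobolev : MemSobolev 2 D θ
  equation : ∀ φ, MemH20 D φ → fourthOrderForm D b τ θ φ = 0
  boundary : MemH20 D (fun x => θ x - g x)

end

/-! Write `A` for the homogenized coefficient, `b = a(·/ε)`, `v = (Δ + τ)u₀`, `β` for the bulk
corrector, `W` for the error and `P = (Δ + τ)W`. The cell equation says that `ε²Δ` applied to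
`χ(·/ε)` is `A/b - 1`. Hence `ε²(Δ + τ)β = (A/b - 1)v + R` with `R = 2ε (∇χ)(·/ε)·∇v + ε² χ(·/ε)(Δ +
τ)v`, and the oscillating term of order one is exactly what turns `P + R` into `(Δ + τ)uε - (A/b)v -
ε(Δ + τ)θ`. Multiplied by `b`, this is the difference of the fluxes in the three equations. Testing
these equations with `W` and subtracting removes `h` and leaves `∫ b P (P + R) + τ² W (W + r) = 0`,
where `r = ε²β`. Completing squares (`sq_sub_le_of_energy`) bounds `∫ b P² + τ² W²` by `∫ b R² + τ²
r²`, and `ΔW = P - τW` gives the norm of `H²₀` directly: the zero-order term of the operator takes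
the place of a Poincaré inequality.

It remains to see that `R` and `r` are `O(ε)` in `L²`, for which `χ` and `∇χ` must be bounded. Since
`Δχ` is bounded and `χ` is periodic, this follows from a maximum principle for differences `u(x + t
eᵢ) - u(x - t eᵢ)` (`IsPointwisePeriodic.sub_le_of_laplacian_lt`). It is proved for smooth functions
and carried to `χ` by mollification (`MemPeriodicH2.exists_smooth_approx`). The same approximations
justify the product rule for `Δβ` (`IsSmoothApprox.weakLaplacian_mul`). The two derivatives that
fall on `v` account for the `H⁴` norm of `u₀`. -/

/-! ### Classical partial derivatives and test functions. -/

section CoordDeriv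

variable {d k : ℕ} {D : Set (EuclideanSpace ℝ (Fin d))} {φ ψ : EuclideanSpace ℝ (Fin d) → ℝ}

/-- The classical partial derivative in the direction of the `i`-th coordinate. -/
noncomputable def coordDeriv (i : Fin d) (φ : EuclideanSpace ℝ (Fin d) → ℝ)
    (x : EuclideanSpace ℝ (Fin d)) : ℝ :=
  fderiv ℝ φ x (EuclideanSpace.single i (1 : ℝ))

theorem ContDiff.coordDeriv (hφ : ContDiff ℝ ∞ φ) (i : Fin d) :
    ContDiff ℝ ∞ (coordDeriv i φ) :=
  (hφ.fderiv_right (m := ∞) (by simp)).clm_apply contDiff_const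

theorem coordDeriv_mul (hφ : ContDiff ℝ ∞ φ) (hψ : ContDiff ℝ ∞ ψ) (i : Fin d) :
    coordDeriv i (fun x => φ x * ψ x)
      = fun x => coordDeriv i φ x * ψ x + φ x * coordDeriv i ψ x := by
  funext x
  unfold coordDeriv
  rw [fderiv_fun_mul (hφ.differentiable (by simp) x) (hψ.differentiable (by simp) x)]
  simp
  ring

theorem coordDeriv_comm (hφ : ContDiff ℝ ∞ φ) (i j : Fin d) :
    coordDeriv i (coordDeriv j φ) = coordDeriv j (coordDeriv i φ) := by
  have key : ∀ i j : Fin d, ∀ x, coordDeriv i (coordDeriv j φ) x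
      = fderiv ℝ (fderiv ℝ φ) x (EuclideanSpace.single i 1) (EuclideanSpace.single j 1) := by
    intro i j x
    have h : DifferentiableAt ℝ (fderiv ℝ φ) x :=
      (hφ.fderiv_right (m := ∞) (by simp)).differentiable (by simp) x
    unfold coordDeriv
    rw [fderiv_clm_apply h (by fun_prop)]
    simp
  funext x
  rw [key, key]
  exact (hφ.contDiffAt.isSymmSndFDerivAt
    (by simpa using WithTop.coe_le_coe.2 (le_top : (2 : ℕ∞) ≤ ⊤))).eq _ _

@[simp] theorem partialDeriv_zero (s : Fin 0 → Fin d) : partialDeriv s φ = φ := by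
  funext x; simp [partialDeriv]

theorem partialDeriv_succ (hφ : ContDiff ℝ ∞ φ) (s : Fin (k + 1) → Fin d) :
    partialDeriv s φ = coordDeriv (s 0) (partialDeriv (Fin.tail s) φ) := by
  funext x
  unfold partialDeriv coordDeriv
  rw [DifferentiableAt.iteratedFDeriv_succ_apply_left']
  · rfl
  · exact hφ.differentiable_iteratedFDeriv (by exact_mod_cast WithTop.coe_lt_top _) x

theorem ContDiff.partialDeriv (hφ : ContDiff ℝ ∞ φ) (s : Fin k → Fin d) :
    ContDiff ℝ ∞ (partialDeriv s φ) := by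
  induction k with
  | zero => simpa
  | succ k ih => rw [partialDeriv_succ hφ]; exact (ih _).coordDeriv _

theorem partialDeriv_coordDeriv (hφ : ContDiff ℝ ∞ φ) (s : Fin k → Fin d) (i : Fin d) :
    partialDeriv s (coordDeriv i φ) = coordDeriv i (partialDeriv s φ) := by
  induction k with
  | zero => simp
  | succ k ih =>
    rw [partialDeriv_succ (hφ.coordDeriv i), ih, coordDeriv_comm (hφ.partialDeriv _),
      partialDeriv_succ hφ]

theorem partialDeriv_one (hφ : ContDiff ℝ ∞ φ) (i : Fin d) :
    partialDeriv ![i] φ = coordDeriv i φ := by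
  rw [partialDeriv_succ hφ]; simp

theorem partialDeriv_two (hφ : ContDiff ℝ ∞ φ) (i j : Fin d) :
    partialDeriv ![i, j] φ = coordDeriv i (coordDeriv j φ) := by
  rw [partialDeriv_succ hφ, partialDeriv_succ hφ]; simp [Fin.tail]

theorem partialDeriv_three (hφ : ContDiff ℝ ∞ φ) (i j l : Fin d) :
    partialDeriv ![i, j, l] φ = coordDeriv i (coordDeriv j (coordDeriv l φ)) := by
  rw [partialDeriv_succ hφ, partialDeriv_succ hφ, partialDeriv_succ hφ]; simp [Fin.tail]

theorem partialDeriv_four (hφ : ContDiff ℝ ∞ φ) (i j l m : Fin d) :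
    partialDeriv ![i, j, l, m] φ
      = coordDeriv i (coordDeriv j (coordDeriv l (coordDeriv m φ))) := by
  rw [partialDeriv_succ hφ, partialDeriv_succ hφ, partialDeriv_succ hφ, partialDeriv_succ hφ]
  simp [Fin.tail]

theorem tsupport_coordDeriv_subset (i : Fin d) : tsupport (coordDeriv i φ) ⊆ tsupport φ :=
  tsupport_fderiv_apply_subset ℝ _

namespace IsTestFunction

theorem coordDeriv (hφ : IsTestFunction D φ) (i : Fin d) :
    IsTestFunction D (coordDeriv i φ) where
  contDiff := hφ.contDiff.coordDeriv i
  hasCompactSupport := hφ.hasCompactSupport.fderiv_apply ℝ _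
  tsupport_subset := (tsupport_coordDeriv_subset i).trans hφ.tsupport_subset

theorem partialDeriv (hφ : IsTestFunction D φ) (s : Fin k → Fin d) :
    IsTestFunction D (partialDeriv s φ) := by
  induction k with
  | zero => simpa
  | succ k ih => rw [partialDeriv_succ hφ.contDiff]; exact (ih _).coordDeriv _

theorem mul_left (hφ : IsTestFunction D φ) (hψ : ContDiff ℝ ∞ ψ) :
    IsTestFunction D (fun x => ψ x * φ x) where
  contDiff := hψ.mul hφ.contDiff
  hasCompactSupport := hφ.hasCompactSupport.mul_left
  tsupport_subset := (tsupport_mul_subset_right (f := ψ) (g := φ)).trans hφ.tsupport_subset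

theorem const_mul (hφ : IsTestFunction D φ) (c : ℝ) : IsTestFunction D (fun x => c * φ x) :=
  hφ.mul_left contDiff_const

theorem add (hφ : IsTestFunction D φ) (hψ : IsTestFunction D ψ) :
    IsTestFunction D (fun x => φ x + ψ x) where
  contDiff := hφ.contDiff.add hψ.contDiff
  hasCompactSupport := hφ.hasCompactSupport.add hψ.hasCompactSupport
  tsupport_subset := (tsupport_add φ ψ).trans
    (union_subset hφ.tsupport_subset hψ.tsupport_subset)

theorem eq_zero_of_notMem (hφ : IsTestFunction D φ) {x : EuclideanSpace ℝ (Fin d)}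
    (hx : x ∉ D) : φ x = 0 :=
  image_eq_zero_of_notMem_tsupport fun h => hx (hφ.tsupport_subset h)

theorem setIntegral_mul_eq (hφ : IsTestFunction D φ) (u : EuclideanSpace ℝ (Fin d) → ℝ) :
    ∫ x in D, u x * φ x = ∫ x, u x * φ x :=
  setIntegral_eq_integral_of_forall_compl_eq_zero fun x hx => by
    simp [hφ.eq_zero_of_notMem hx]

theorem integrable_mul (hφ : IsTestFunction D φ) {u : EuclideanSpace ℝ (Fin d) → ℝ}
    (hu : LocallyIntegrableOn u D) : Integrable (fun x => u x * φ x) := by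
  have h1 : IntegrableOn u (tsupport φ) :=
    hu.integrableOn_compact_subset hφ.tsupport_subset hφ.hasCompactSupport
  have h2 : IntegrableOn (fun x => u x * φ x) (tsupport φ) :=
    h1.mul_continuousOn hφ.contDiff.continuous.continuousOn hφ.hasCompactSupport
  refine (integrableOn_iff_integrable_of_support_subset ?_).1 h2
  exact (Function.support_mul_subset_right u φ).trans (subset_tsupport φ)

end IsTestFunction

end CoordDeriv

/-! ### Weak derivatives: linearity and uniqueness. -/

section WeakDeriv

variable {d k : ℕ} {D : Set (EuclideanSpace ℝ (Fin d))} {s : Fin k → Fin d}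
  {u v w z φ : EuclideanSpace ℝ (Fin d) → ℝ}

theorem ContDiff.isWeakDeriv (hu : ContDiff ℝ ∞ u) (D : Set (EuclideanSpace ℝ (Fin d)))
    (s : Fin k → Fin d) : IsWeakDeriv D s u (_root_.partialDeriv s u) := by
  refine ⟨(hu.continuous.locallyIntegrable).locallyIntegrableOn D,
    ((hu.partialDeriv s).continuous.locallyIntegrable).locallyIntegrableOn D, ?_⟩
  intro φ hφ
  rw [(hφ.partialDeriv s).setIntegral_mul_eq, hφ.setIntegral_mul_eq]
  induction k generalizing u with
  | zero => simp
  | succ k ih =>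
    have hT := hφ.partialDeriv (Fin.tail s)
    have li : ∀ {f : EuclideanSpace ℝ (Fin d) → ℝ}, ContDiff ℝ ∞ f →
        LocallyIntegrableOn f D := fun hf =>
      (hf.continuous.locallyIntegrable).locallyIntegrableOn D
    -- One integration by parts moves the outermost derivative from `φ` to `u`. The induction
    -- hypothesis is then applied to `∂u`, which is why `u` is generalized.
    have h := integral_mul_fderiv_eq_neg_fderiv_mul_of_integrable (μ := volume)
      (f := u) (g := _root_.partialDeriv (Fin.tail s) φ) (v := EuclideanSpace.single (s 0) (1 : ℝ))
      (hT.integrable_mul (li (hu.coordDeriv (s 0))))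
      ((hT.coordDeriv (s 0)).integrable_mul (li hu))
      (hT.integrable_mul (li hu))
      (fun x _ => hu.differentiable (by simp) x)
      (fun x _ => hT.contDiff.differentiable (by simp) x)
    rw [partialDeriv_succ hφ.contDiff]
    refine h.trans ?_
    have h2 := ih (hu.coordDeriv (s 0)) (Fin.tail s)
    rw [partialDeriv_coordDeriv hu, ← partialDeriv_succ hu] at h2
    change -∫ x, _root_.coordDeriv (s 0) u x * _root_.partialDeriv (Fin.tail s) φ x = _
    rw [h2]; ring

namespace IsWeakDeriv

theorem add {u' w' : EuclideanSpace ℝ (Fin d) → ℝ} (h : IsWeakDeriv D s u w)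
    (h' : IsWeakDeriv D s u' w') :
    IsWeakDeriv D s (fun x => u x + u' x) (fun x => w x + w' x) := by
  refine ⟨h.1.add h'.1, h.2.add h'.2, fun φ hφ => ?_⟩
  have hs := hφ.partialDeriv s
  simp only [add_mul]
  rw [integral_add (hs.integrable_mul h.1).integrableOn (hs.integrable_mul h'.1).integrableOn,
    integral_add (hφ.integrable_mul h.2).integrableOn (hφ.integrable_mul h'.2).integrableOn,
    h.3 φ hφ, h'.3 φ hφ]
  ring

theorem const_mul (h : IsWeakDeriv D s u w) (c : ℝ) :
    IsWeakDeriv D s (fun x => c * u x) (fun x => c * w x) := by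
  refine ⟨h.1.smul c, h.2.smul c, fun φ hφ => ?_⟩
  simp only [mul_assoc, integral_const_mul, h.3 φ hφ]
  ring

theorem sub {u' w' : EuclideanSpace ℝ (Fin d) → ℝ} (h : IsWeakDeriv D s u w)
    (h' : IsWeakDeriv D s u' w') :
    IsWeakDeriv D s (fun x => u x - u' x) (fun x => w x - w' x) := by
  simpa [sub_eq_add_neg] using h.add (h'.const_mul (-1))

theorem sum {ι : Type*} (t : Finset ι) {f g : ι → EuclideanSpace ℝ (Fin d) → ℝ}
    (h : ∀ j ∈ t, IsWeakDeriv D s (f j) (g j)) :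
    IsWeakDeriv D s (fun x => ∑ j ∈ t, f j x) (fun x => ∑ j ∈ t, g j x) := by
  classical
  induction t using Finset.induction_on with
  | empty =>
    refine ⟨?_, ?_, by simp⟩ <;>
      simpa using (locallyIntegrable_zero (X := EuclideanSpace ℝ (Fin d)) (ε'' := ℝ)
        (μ := volume)).locallyIntegrableOn D
  | insert a t ha ih =>
    simp only [Finset.sum_insert ha]
    exact (h a (by simp)).add (ih fun j hj => h j (by simp [hj]))

end IsWeakDeriv

/-- The fundamental lemma of the calculus of variations. Besides uniqueness of weak derivatives it
serves to identify a Laplacian that is known only as a whole, not term by term. -/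
theorem ae_eq_of_integral_mul_test_eq (hD : IsOpen D) (hw : LocallyIntegrableOn w D)
    (hz : LocallyIntegrableOn z D)
    (h : ∀ φ, IsTestFunction D φ → ∫ x in D, w x * φ x = ∫ x in D, z x * φ x) :
    w =ᵐ[volume.restrict D] z := by
  have := hD.ae_eq_zero_of_integral_contDiff_smul_eq_zero (μ := volume) (f := fun x => w x - z x)
    (hw.sub hz) (fun g hg hgc hgs => by
      have hφ : IsTestFunction D g := ⟨hg, hgc, hgs⟩
      have h1 := h g hφ
      rw [hφ.setIntegral_mul_eq, hφ.setIntegral_mul_eq] at h1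
      have : ∀ x, g x • (w x - z x) = w x * g x - z x * g x := fun x => by
        simp only [smul_eq_mul]; ring
      simp only [this]
      rw [integral_sub (hφ.integrable_mul hw) (hφ.integrable_mul hz), h1, sub_self])
  rw [Filter.EventuallyEq, ae_restrict_iff' hD.measurableSet]
  filter_upwards [this] with x hx hxD
  linarith [hx hxD]

theorem IsWeakDeriv.ae_eq (hD : IsOpen D) (hw : IsWeakDeriv D s u w) (hz : IsWeakDeriv D s u z) :
    w =ᵐ[volume.restrict D] z := by
  refine ae_eq_of_integral_mul_test_eq hD hw.2 hz.2 fun φ hφ => ?_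
  have := (hw.3 φ hφ).symm.trans (hz.3 φ hφ)
  exact mul_left_cancel₀ (pow_ne_zero k (by norm_num)) this

theorem IsWeakDeriv.weakDeriv (h : IsWeakDeriv D s u w) : IsWeakDeriv D s u (weakDeriv D s u) := by
  have h' : ∃ w, IsWeakDeriv D s u w := ⟨w, h⟩
  rw [_root_.weakDeriv, dif_pos h']
  exact h'.choose_spec

theorem IsWeakDeriv.weakDeriv_ae_eq (hD : IsOpen D) (h : IsWeakDeriv D s u w) :
    _root_.weakDeriv D s u =ᵐ[volume.restrict D] w :=
  h.weakDeriv.ae_eq hD h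

end WeakDeriv

/-! ### Sobolev spaces and the closure of the test functions. -/

section Sobolev

variable {d k m : ℕ} {D : Set (EuclideanSpace ℝ (Fin d))}
  {u v φ : EuclideanSpace ℝ (Fin d) → ℝ}

namespace MemSobolev

theorem isWeakDeriv (hu : MemSobolev m D u) (hk : k ≤ m) (s : Fin k → Fin d) :
    IsWeakDeriv D s u (weakDeriv D s u) :=
  let ⟨_, h, _⟩ := hu.2 k hk s
  h.weakDeriv

theorem memLp_weakDeriv (hD : IsOpen D) (hu : MemSobolev m D u) (hk : k ≤ m)
    (s : Fin k → Fin d) : MemLp (weakDeriv D s u) 2 (volume.restrict D) :=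
  let ⟨_, h, h'⟩ := hu.2 k hk s
  (memLp_congr_ae (h.weakDeriv_ae_eq hD)).2 h'

theorem memLp_weakLaplacian (hD : IsOpen D) (hu : MemSobolev m D u) (hm : 2 ≤ m) :
    MemLp (weakLaplacian D u) 2 (volume.restrict D) :=
  memLp_finsetSum _ fun i _ => hu.memLp_weakDeriv hD hm ![i, i]

theorem add (hu : MemSobolev m D u) (hv : MemSobolev m D v) :
    MemSobolev m D (fun x => u x + v x) := by
  refine ⟨hu.1.add hv.1, fun k hk s => ?_⟩
  obtain ⟨w, hw, hw'⟩ := hu.2 k hk s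
  obtain ⟨z, hz, hz'⟩ := hv.2 k hk s
  exact ⟨_, hw.add hz, hw'.add hz'⟩

theorem const_mul (hu : MemSobolev m D u) (c : ℝ) : MemSobolev m D (fun x => c * u x) := by
  refine ⟨hu.1.const_mul c, fun k hk s => ?_⟩
  obtain ⟨w, hw, hw'⟩ := hu.2 k hk s
  exact ⟨_, hw.const_mul c, hw'.const_mul c⟩

theorem sub (hu : MemSobolev m D u) (hv : MemSobolev m D v) :
    MemSobolev m D (fun x => u x - v x) := by
  simpa [sub_eq_add_neg] using hu.add (hv.const_mul (-1))

theorem weakLaplacian_add (hD : IsOpen D) (hu : MemSobolev 2 D u) (hv : MemSobolev 2 D v) :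
    weakLaplacian D (fun x => u x + v x)
      =ᵐ[volume.restrict D] fun x => weakLaplacian D u x + weakLaplacian D v x := by
  have h : ∀ i : Fin d, ∀ᵐ x ∂volume.restrict D, weakDeriv D ![i, i] (fun x => u x + v x) x
      = weakDeriv D ![i, i] u x + weakDeriv D ![i, i] v x := fun i =>
    ((hu.isWeakDeriv le_rfl _).add (hv.isWeakDeriv le_rfl _)).weakDeriv_ae_eq hD
  filter_upwards [ae_all_iff.2 h] with x hx
  simp only [weakLaplacian, hx, Finset.sum_add_distrib]

theorem weakLaplacian_const_mul (hD : IsOpen D) (hu : MemSobolev 2 D u) (c : ℝ) :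
    weakLaplacian D (fun x => c * u x)
      =ᵐ[volume.restrict D] fun x => c * weakLaplacian D u x := by
  have h : ∀ i : Fin d, ∀ᵐ x ∂volume.restrict D, weakDeriv D ![i, i] (fun x => c * u x) x
      = c * weakDeriv D ![i, i] u x := fun i =>
    ((hu.isWeakDeriv le_rfl _).const_mul c).weakDeriv_ae_eq hD
  filter_upwards [ae_all_iff.2 h] with x hx
  simp only [weakLaplacian, hx, Finset.mul_sum]

theorem weakLaplacian_sub (hD : IsOpen D) (hu : MemSobolev 2 D u) (hv : MemSobolev 2 D v) :
    weakLaplacian D (fun x => u x - v x)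
      =ᵐ[volume.restrict D] fun x => weakLaplacian D u x - weakLaplacian D v x := by
  have h : ∀ i : Fin d, ∀ᵐ x ∂volume.restrict D, weakDeriv D ![i, i] (fun x => u x - v x) x
      = weakDeriv D ![i, i] u x - weakDeriv D ![i, i] v x := fun i =>
    ((hu.isWeakDeriv le_rfl _).sub (hv.isWeakDeriv le_rfl _)).weakDeriv_ae_eq hD
  filter_upwards [ae_all_iff.2 h] with x hx
  simp only [weakLaplacian, hx, Finset.sum_sub_distrib]

theorem integral_mul_laplacian (hu : MemSobolev 2 D u) (hφ : IsTestFunction D φ) :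
    ∫ x in D, u x * ∑ i, coordDeriv i (coordDeriv i φ) x
      = ∫ x in D, weakLaplacian D u x * φ x := by
  simp only [weakLaplacian, Finset.mul_sum, Finset.sum_mul]
  rw [integral_finsetSum, integral_finsetSum]
  · refine Finset.sum_congr rfl fun i _ => ?_
    have h := (hu.isWeakDeriv le_rfl ![i, i]).3 φ hφ
    rw [partialDeriv_two hφ.contDiff] at h
    simpa using h
  · exact fun i _ => (hφ.integrable_mul (hu.isWeakDeriv le_rfl ![i, i]).2).integrableOn
  · exact fun i _ => (((hφ.coordDeriv i).coordDeriv i).integrable_mul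
      (hu.isWeakDeriv le_rfl ![i, i]).1).integrableOn

theorem sq_sobolevNorm (m : ℕ) (D : Set (EuclideanSpace ℝ (Fin d)))
    (u : EuclideanSpace ℝ (Fin d) → ℝ) : sobolevNorm m D u ^ 2
      = ∑ k ∈ Finset.range (m + 1), ∑ i : Fin k → Fin d, ∫ x in D, weakDeriv D i u x ^ 2 :=
  Real.sq_sqrt <| Finset.sum_nonneg fun _ _ => Finset.sum_nonneg fun _ _ =>
    integral_nonneg fun _ => sq_nonneg _

/-- Pointwise `(s + t)² ≤ 2s² + 2t²`. This replaces the triangle inequality, since closure of `H²₀`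
under sums needs no sharp constant. -/
theorem sq_sobolevNorm_add_le (hD : IsOpen D) (hu : MemSobolev m D u) (hv : MemSobolev m D v) :
    sobolevNorm m D (fun x => u x + v x) ^ 2
      ≤ 2 * sobolevNorm m D u ^ 2 + 2 * sobolevNorm m D v ^ 2 := by
  simp only [sq_sobolevNorm, Finset.mul_sum, ← Finset.sum_add_distrib]
  refine Finset.sum_le_sum fun k hk => Finset.sum_le_sum fun s _ => ?_
  have hk : k ≤ m := by simpa [Nat.lt_succ_iff] using hk
  have hu2 := (hu.memLp_weakDeriv hD hk s).integrable_sq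
  have hv2 := (hv.memLp_weakDeriv hD hk s).integrable_sq
  rw [← integral_const_mul, ← integral_const_mul,
    ← integral_add (hu2.const_mul 2) (hv2.const_mul 2)]
  refine integral_mono_ae ((hu.add hv).memLp_weakDeriv hD hk s).integrable_sq
    ((hu2.const_mul 2).add (hv2.const_mul 2)) ?_
  filter_upwards [((hu.isWeakDeriv hk s).add (hv.isWeakDeriv hk s)).weakDeriv_ae_eq hD] with x hx
  rw [hx]
  nlinarith [sq_nonneg (weakDeriv D s u x - weakDeriv D s v x)]

theorem sq_sobolevNorm_const_mul (hD : IsOpen D) (hu : MemSobolev m D u) (c : ℝ) :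
    sobolevNorm m D (fun x => c * u x) ^ 2 = c ^ 2 * sobolevNorm m D u ^ 2 := by
  simp only [sq_sobolevNorm, Finset.mul_sum]
  refine Finset.sum_congr rfl fun k hk => Finset.sum_congr rfl fun s _ => ?_
  have hk : k ≤ m := by simpa [Nat.lt_succ_iff] using hk
  rw [← integral_const_mul]
  refine integral_congr_ae ?_
  filter_upwards [((hu.isWeakDeriv hk s).const_mul c).weakDeriv_ae_eq hD] with x hx
  rw [hx]; ring

theorem integrable_sum_sq_weakDeriv (hD : IsOpen D) (hu : MemSobolev m D u) :
    Integrable (fun x => ∑ k ∈ Finset.range (m + 1), ∑ i : Fin k → Fin d, weakDeriv D i u x ^ 2)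
      (volume.restrict D) :=
  integrable_finsetSum _ fun _ hk => integrable_finsetSum _ fun s _ =>
    (hu.memLp_weakDeriv hD (by simpa [Nat.lt_succ_iff] using hk) s).integrable_sq

theorem integral_sum_sq_weakDeriv (hD : IsOpen D) (hu : MemSobolev m D u) :
    ∫ x in D, ∑ k ∈ Finset.range (m + 1), ∑ i : Fin k → Fin d, weakDeriv D i u x ^ 2
      = sobolevNorm m D u ^ 2 := by
  have h : ∀ k ∈ Finset.range (m + 1), ∀ s : Fin k → Fin d,
      Integrable (fun x => weakDeriv D s u x ^ 2) (volume.restrict D) := fun k hk s =>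
    (hu.memLp_weakDeriv hD (by simpa [Nat.lt_succ_iff] using hk) s).integrable_sq
  rw [sq_sobolevNorm, integral_finsetSum _ fun k hk =>
    integrable_finsetSum _ fun s _ => h k hk s]
  exact Finset.sum_congr rfl fun k hk => integral_finsetSum _ fun s _ => h k hk s

end MemSobolev

theorem IsTestFunction.memSobolev (hφ : IsTestFunction D φ) (m : ℕ) : MemSobolev m D φ := by
  have h : ∀ {ψ}, IsTestFunction D ψ → MemLp ψ 2 (volume.restrict D) := fun hψ =>
    (hψ.contDiff.continuous.memLp_of_hasCompactSupport hψ.hasCompactSupport).restrict D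
  exact ⟨h hφ, fun k _ s => ⟨_, hφ.contDiff.isWeakDeriv D s, h (hφ.partialDeriv s)⟩⟩

theorem memH20_iff : MemH20 D u ↔ MemSobolev 2 D u ∧ ∀ δ : ℝ, 0 < δ →
    ∃ φ, IsTestFunction D φ ∧ sobolevNorm 2 D (fun x => u x - φ x) ^ 2 < δ := by
  refine and_congr_right fun _ => ⟨fun h δ hδ => ?_, fun h δ hδ => ?_⟩
  · obtain ⟨φ, hφ, h'⟩ := h (Real.sqrt δ) (Real.sqrt_pos.2 hδ)
    exact ⟨φ, hφ, (Real.lt_sqrt (Real.sqrt_nonneg _)).1 h'⟩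
  · obtain ⟨φ, hφ, h'⟩ := h (δ ^ 2) (by positivity)
    exact ⟨φ, hφ, lt_of_pow_lt_pow_left₀ 2 hδ.le h'⟩

theorem MemH20.add (hD : IsOpen D) (hu : MemH20 D u) (hv : MemH20 D v) :
    MemH20 D (fun x => u x + v x) := by
  rw [memH20_iff] at *
  refine ⟨hu.1.add hv.1, fun δ hδ => ?_⟩
  obtain ⟨φ, hφ, h⟩ := hu.2 (δ / 4) (by positivity)
  obtain ⟨ψ, hψ, h'⟩ := hv.2 (δ / 4) (by positivity)
  refine ⟨_, hφ.add hψ, ?_⟩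
  have := MemSobolev.sq_sobolevNorm_add_le hD (hu.1.sub (hφ.memSobolev 2))
    (hv.1.sub (hψ.memSobolev 2))
  have e : (fun x => u x + v x - (φ x + ψ x)) = fun x => u x - φ x + (v x - ψ x) := by
    funext x; ring
  rw [e]
  linarith

theorem MemH20.const_mul (hD : IsOpen D) (hu : MemH20 D u) (c : ℝ) :
    MemH20 D (fun x => c * u x) := by
  rw [memH20_iff] at *
  refine ⟨hu.1.const_mul c, fun δ hδ => ?_⟩
  -- The `+ 1` keeps the tolerance meaningful when `c = 0`.
  obtain ⟨φ, hφ, h⟩ := hu.2 (δ / (c ^ 2 + 1)) (by positivity)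
  refine ⟨_, hφ.const_mul c, ?_⟩
  have := MemSobolev.sq_sobolevNorm_const_mul hD (hu.1.sub (hφ.memSobolev 2)) c
  simp only [mul_sub] at this
  rw [this]
  rw [lt_div_iff₀ (by positivity)] at h
  nlinarith [sq_nonneg (sobolevNorm 2 D fun x => u x - φ x)]

theorem MemH20.sub (hD : IsOpen D) (hu : MemH20 D u) (hv : MemH20 D v) :
    MemH20 D (fun x => u x - v x) := by
  simpa [sub_eq_add_neg] using hu.add hD (hv.const_mul hD (-1))

end Sobolev

/-! ### A maximum principle: periodic functions with bounded Laplacian are Lipschitz. -/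

section MaximumPrinciple

variable {d : ℕ} {u : EuclideanSpace ℝ (Fin d) → ℝ}

/-- A positive second derivative would make `x` a local minimum as well, so `f` would be locally
constant and its second derivative zero. -/
theorem IsLocalMax.deriv_deriv_nonpos {f : ℝ → ℝ} {x : ℝ} (h : IsLocalMax f x)
    (hf : ContinuousAt f x) : deriv (deriv f) x ≤ 0 := by
  by_contra! hpos
  have hmin := isLocalMin_of_deriv_deriv_pos hpos h.deriv_eq_zero hf
  have hconst : f =ᶠ[nhds x] fun _ => f x := by
    filter_upwards [h, hmin] with y hy hy'
    exact le_antisymm hy hy'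
  have := hconst.deriv.deriv_eq
  simp at this
  linarith

/-- Genuine (pointwise) periodicity with respect to `ℤ^d`. -/
def IsPointwisePeriodic (u : EuclideanSpace ℝ (Fin d) → ℝ) : Prop :=
  ∀ i : Fin d, Function.Periodic u (EuclideanSpace.single i (1 : ℝ))

theorem EuclideanSpace.sum_smul_single (x : EuclideanSpace ℝ (Fin d)) :
    ∑ i, x i • EuclideanSpace.single i (1 : ℝ) = x := by
  ext j
  simp [Finset.sum_apply, Pi.single_apply]

theorem exists_mem_periodCell (x : EuclideanSpace ℝ (Fin d)) :
    ∃ y ∈ periodCell d, ∀ g, IsPointwisePeriodic g → g x = g y := by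
  let n : EuclideanSpace ℝ (Fin d) := ∑ i, ⌊x i⌋ • EuclideanSpace.single i (1 : ℝ)
  have hn : ∀ j, n j = ⌊x j⌋ := fun j => by
    simp [n, Finset.sum_apply, Pi.single_apply]
  refine ⟨x - n, fun i => ?_, fun g hg => ?_⟩
  · have : (x - n) i = Int.fract (x i) := by rw [PiLp.sub_apply, hn]; rfl
    rw [this]
    exact ⟨Int.fract_nonneg _, (Int.fract_lt_one _).le⟩
  · have hp : Function.Periodic g n :=
      Finset.sum_induction _ (Function.Periodic g) (fun _ _ => Function.Periodic.add_period)
        (fun x => by simp) fun i _ => (hg i).zsmul _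
    simpa using (hp (x - n))

theorem isCompact_periodCell (d : ℕ) : IsCompact (periodCell d) := by
  have h : periodCell d = (EuclideanSpace.equiv (Fin d) ℝ).toHomeomorph ⁻¹' Icc 0 1 := by
    ext y
    simp [periodCell, Pi.le_def, forall_and]
  rw [h, Homeomorph.isCompact_preimage]
  exact isCompact_Icc

theorem hasDerivAt_add_smul_single (hu : ContDiff ℝ ∞ u) (p : EuclideanSpace ℝ (Fin d))
    (i : Fin d) (c t : ℝ) :
    HasDerivAt (fun s : ℝ => u (p + (c * s) • EuclideanSpace.single i (1 : ℝ)))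
      (c * coordDeriv i u (p + (c * t) • EuclideanSpace.single i (1 : ℝ))) t := by
  have h1 : HasDerivAt (fun s : ℝ => p + (c * s) • EuclideanSpace.single i (1 : ℝ))
      (c • EuclideanSpace.single i (1 : ℝ)) t := by
    simpa using (((hasDerivAt_id t).const_mul c).smul_const
      (EuclideanSpace.single i (1 : ℝ))).const_add p
  have h2 := ((hu.differentiable (by simp)) (p + (c * t) • EuclideanSpace.single i (1 : ℝ))
    ).hasFDerivAt.comp_hasDerivAt t h1
  refine HasDerivAt.congr_deriv h2 ?_
  simp [coordDeriv]

/-- Covers both slices of the doubled function below: `b = c = 1`, `N = 0` translates the two points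
together, while `b = 1`, `c = -1` pulls them apart. -/
theorem deriv_deriv_add_smul_single (hu : ContDiff ℝ ∞ u)
    (p q : EuclideanSpace ℝ (Fin d)) (i : Fin d) (b c N t : ℝ) :
    deriv (deriv fun s : ℝ => u (p + (b * s) • EuclideanSpace.single i (1 : ℝ))
        - u (q + (c * s) • EuclideanSpace.single i (1 : ℝ)) - N * (s * (1 / 2 - s))) t
      = b ^ 2 * coordDeriv i (coordDeriv i u) (p + (b * t) • EuclideanSpace.single i (1 : ℝ))
        - c ^ 2 * coordDeriv i (coordDeriv i u) (q + (c * t) • EuclideanSpace.single i (1 : ℝ))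
        + 2 * N := by
  have h1 : (deriv fun s : ℝ => u (p + (b * s) • EuclideanSpace.single i (1 : ℝ))
        - u (q + (c * s) • EuclideanSpace.single i (1 : ℝ)) - N * (s * (1 / 2 - s)))
      = fun s => b * coordDeriv i u (p + (b * s) • EuclideanSpace.single i (1 : ℝ))
        - c * coordDeriv i u (q + (c * s) • EuclideanSpace.single i (1 : ℝ))
        - N * (1 / 2 - 2 * s) := by
    funext s
    have h3 : HasDerivAt (fun s : ℝ => N * (s * (1 / 2 - s))) (N * (1 / 2 - 2 * s)) s := by
      refine (((hasDerivAt_id' s).mul ((hasDerivAt_id' s).const_sub (1 / 2))).const_mul N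
        ).congr_deriv ?_
      ring
    exact (((hasDerivAt_add_smul_single hu p i b s).sub
      (hasDerivAt_add_smul_single hu q i c s)).sub h3).deriv
  rw [h1]
  have h3 : HasDerivAt (fun s : ℝ => N * (1 / 2 - 2 * s)) (-2 * N) t := by
    refine ((((hasDerivAt_id' t).const_mul 2).const_sub (1 / 2)).const_mul N).congr_deriv ?_
    ring
  have hu' := hu.coordDeriv i
  refine (((((hasDerivAt_add_smul_single hu' p i b t).const_mul b).sub
    ((hasDerivAt_add_smul_single hu' q i c t).const_mul c)).sub h3).deriv).trans ?_
  ring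

/-- Doubling of variables. The difference of the two sides, as a function `G` of `(x, t)`, is
periodic in `x` and vanishes at `t = 0` and, by periodicity of `u`, at `t = 1/2`. A positive maximum
is therefore interior in `t`. There the second derivatives in `t` and in `x_j`, `j ≠ i`, are
nonpositive, and their sum is `Δu(x + t eᵢ) - Δu(x - t eᵢ) + 2N`, which is positive because `|Δu| <
N`. -/
theorem IsPointwisePeriodic.sub_le_of_laplacian_lt (hper : IsPointwisePeriodic u)
    (hu : ContDiff ℝ ∞ u) {N : ℝ}
    (hN : ∀ x, |∑ j, coordDeriv j (coordDeriv j u) x| < N) (i : Fin d)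
    (x : EuclideanSpace ℝ (Fin d)) {t : ℝ} (ht : t ∈ Icc (0 : ℝ) (1 / 2)) :
    u (x + t • EuclideanSpace.single i (1 : ℝ)) - u (x - t • EuclideanSpace.single i (1 : ℝ))
      ≤ N * (t * (1 / 2 - t)) := by
  set e : Fin d → EuclideanSpace ℝ (Fin d) := fun j => EuclideanSpace.single j (1 : ℝ)
  let G : EuclideanSpace ℝ (Fin d) → ℝ → ℝ := fun x t =>
    u (x + t • e i) - u (x - t • e i) - N * (t * (1 / 2 - t))
  have hGc : Continuous (fun p : EuclideanSpace ℝ (Fin d) × ℝ => G p.1 p.2) := by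
    have := hu.continuous
    fun_prop
  have hGper : ∀ t, IsPointwisePeriodic (fun x => G x t) := by
    intro t j x
    have h1 := hper j (x + t • e i)
    have h2 := hper j (x - t • e i)
    simp only [G]
    rw [add_right_comm, h1, add_sub_right_comm, h2]
  by_contra! hcon
  obtain ⟨⟨x', t'⟩, hmem, hmax⟩ := ((isCompact_periodCell d).prod
    (isCompact_Icc (a := (0 : ℝ)) (b := 1 / 2))).exists_isMaxOn
    ⟨(0, 0), by simp [periodCell], by norm_num⟩ hGc.continuousOn
  have hmax' : ∀ y, ∀ s ∈ Icc (0 : ℝ) (1 / 2), G y s ≤ G x' t' := by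
    intro y s hs
    obtain ⟨z, hz, hz'⟩ := exists_mem_periodCell y
    have h1 : G y s = G z s := hz' _ (hGper s)
    rw [h1]
    exact hmax (a := (z, s)) ⟨hz, hs⟩
  have hpos : 0 < G x' t' := lt_of_lt_of_le (by simp only [G]; linarith) (hmax' x t ht)
  have h0 : t' ≠ 0 := by
    rintro rfl
    simp [G] at hpos
  -- At `t = 1/2` the two points differ by a full period, so `G` vanishes.
  have h2 : t' ≠ 1 / 2 := by
    rintro rfl
    have h := hper i (x' - (1 / 2 : ℝ) • e i)
    have e1 : x' - (1 / 2 : ℝ) • e i + EuclideanSpace.single i 1 = x' + (1 / 2 : ℝ) • e i := by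
      change x' - (1 / 2 : ℝ) • e i + e i = _
      module
    rw [e1] at h
    simp only [G, h] at hpos
    norm_num at hpos
  have hlt : t' ∈ Ioo (0 : ℝ) (1 / 2) :=
    ⟨lt_of_le_of_ne hmem.2.1 (Ne.symm h0), lt_of_le_of_ne hmem.2.2 h2⟩
  have hj : ∀ j, j ≠ i → coordDeriv j (coordDeriv j u) (x' + t' • e i)
      - coordDeriv j (coordDeriv j u) (x' - t' • e i) ≤ 0 := by
    intro j _
    have hc := deriv_deriv_add_smul_single hu (x' + t' • e i) (x' - t' • e i) j 1 1 0 0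
    simp only [one_mul, zero_mul, sub_zero, mul_zero, add_zero, zero_smul, one_pow] at hc
    rw [← hc]
    refine IsLocalMax.deriv_deriv_nonpos (Filter.Eventually.of_forall fun s => ?_) ?_
    · have := hmax' (x' + s • e j) t' hmem.2
      simp only [G] at this
      simp only [zero_smul, add_zero]
      have e1 : x' + t' • e i + s • e j = x' + s • e j + t' • e i := by abel
      have e2 : x' - t' • e i + s • e j = x' + s • e j - t' • e i := by abel
      change u (x' + t' • e i + s • e j) - u (x' - t' • e i + s • e j) ≤ _
      rw [e1, e2]
      linarith
    · have := hu.continuous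
      fun_prop
  have hi : coordDeriv i (coordDeriv i u) (x' + t' • e i)
      - coordDeriv i (coordDeriv i u) (x' - t' • e i) + 2 * N ≤ 0 := by
    have hc := deriv_deriv_add_smul_single hu x' x' i 1 (-1) N t'
    simp only [one_mul, one_pow, neg_mul, even_two, Even.neg_pow, neg_smul,
      ← sub_eq_add_neg] at hc
    rw [← hc]
    refine IsLocalMax.deriv_deriv_nonpos ?_ ?_
    · filter_upwards [Ioo_mem_nhds hlt.1 hlt.2] with s hs
      exact hmax' x' s ⟨hs.1.le, hs.2.le⟩
    · have := hu.continuous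
      fun_prop
  have hsum : ∑ j, coordDeriv j (coordDeriv j u) (x' + t' • e i)
      - ∑ j, coordDeriv j (coordDeriv j u) (x' - t' • e i) + 2 * N ≤ 0 := by
    rw [← Finset.sum_sub_distrib, ← Finset.add_sum_erase _ _ (Finset.mem_univ i)]
    have := Finset.sum_nonpos (s := Finset.univ.erase i)
      (f := fun j => coordDeriv j (coordDeriv j u) (x' + t' • e i)
      - coordDeriv j (coordDeriv j u) (x' - t' • e i)) fun j hj' => hj j (by simpa using hj')
    linarith
  have b1 := abs_lt.1 (hN (x' + t' • e i))
  have b2 := abs_lt.1 (hN (x' - t' • e i))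
  linarith [b1.1, b2.2]

theorem IsPointwisePeriodic.abs_sub_le_of_laplacian_le (hper : IsPointwisePeriodic u)
    (hu : ContDiff ℝ ∞ u) {M : ℝ}
    (hM : ∀ x, |∑ j, coordDeriv j (coordDeriv j u) x| ≤ M) (i : Fin d)
    (x : EuclideanSpace ℝ (Fin d)) {t : ℝ} (ht : t ∈ Icc (0 : ℝ) (1 / 2)) :
    |u (x + t • EuclideanSpace.single i (1 : ℝ)) - u (x - t • EuclideanSpace.single i (1 : ℝ))|
      ≤ M * (t * (1 / 2 - t)) := by
  have key : ∀ v : EuclideanSpace ℝ (Fin d) → ℝ, IsPointwisePeriodic v → ContDiff ℝ ∞ v →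
      (∀ x, |∑ j, coordDeriv j (coordDeriv j v) x| ≤ M) →
      v (x + t • EuclideanSpace.single i (1 : ℝ)) - v (x - t • EuclideanSpace.single i (1 : ℝ))
        ≤ M * (t * (1 / 2 - t)) := by
    intro v hper hv hM
    refine le_of_forall_pos_le_add fun δ hδ => ?_
    have := hper.sub_le_of_laplacian_lt hv (N := M + δ)
      (fun x => lt_of_le_of_lt (hM x) (by linarith)) i x ht
    have h4 : t * (1 / 2 - t) ≤ 1 := by nlinarith [ht.1, ht.2]
    nlinarith
  refine abs_le.2 ⟨?_, key u hper hu hM⟩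
  have hneg : ∀ (j : Fin d) (v : EuclideanSpace ℝ (Fin d) → ℝ),
      coordDeriv j (fun x => -v x) = fun x => -coordDeriv j v x := by
    intro j v
    funext x
    simp [coordDeriv]
  have := key (fun x => -u x) (fun j x => by simp only; rw [hper j x]) hu.neg (fun x => by
    simp only [hneg, Finset.sum_neg_distrib, abs_neg]
    exact hM x)
  linarith

/-- Divide the bound on the symmetric difference by `t` and let `t → 0`. The constant is not
optimal, which does no harm. -/
theorem IsPointwisePeriodic.abs_coordDeriv_le_of_laplacian_le (hper : IsPointwisePeriodic u)
    (hu : ContDiff ℝ ∞ u) {M : ℝ}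
    (hM : ∀ x, |∑ j, coordDeriv j (coordDeriv j u) x| ≤ M) (i : Fin d)
    (x : EuclideanSpace ℝ (Fin d)) : |coordDeriv i u x| ≤ M := by
  have hM0 : 0 ≤ M := (abs_nonneg _).trans (hM x)
  have h1 : HasDerivAt (fun s : ℝ => u (x + (1 * s) • EuclideanSpace.single i (1 : ℝ))
      - u (x + (-1 * s) • EuclideanSpace.single i (1 : ℝ))) (2 * coordDeriv i u x) 0 := by
    refine ((hasDerivAt_add_smul_single hu x i 1 0).sub
      (hasDerivAt_add_smul_single hu x i (-1) 0)).congr_deriv ?_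
    simp; ring
  have h2 := h1.tendsto_slope_zero_right.abs
  have h3 : |2 * coordDeriv i u x| ≤ M := by
    refine le_of_tendsto h2 ?_
    filter_upwards [Ioo_mem_nhdsGT (show (0 : ℝ) < 1 / 2 by norm_num)] with t ht
    have h := hper.abs_sub_le_of_laplacian_le hu hM i x ⟨ht.1.le, ht.2.le⟩
    simp only [zero_add, one_mul, mul_zero, zero_smul, add_zero, sub_self, sub_zero, smul_eq_mul,
      neg_mul, neg_smul, ← sub_eq_add_neg, abs_mul, abs_inv, abs_of_pos ht.1]
    rw [inv_mul_le_iff₀ ht.1]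
    refine h.trans ?_
    nlinarith [mul_nonneg hM0 ht.1.le, ht.1, ht.2, mul_nonneg (mul_nonneg hM0 ht.1.le) ht.1.le]
  rw [abs_mul, abs_two] at h3
  linarith [abs_nonneg (coordDeriv i u x)]

/-- By periodicity `x - y` may be taken in the unit cell. Moving one coordinate at a time then takes
`d` steps, each a symmetric difference with `t ≤ 1/2` about the midpoint of the step. -/
theorem IsPointwisePeriodic.abs_sub_le_card_mul (hper : IsPointwisePeriodic u)
    (hu : ContDiff ℝ ∞ u) {M : ℝ}
    (hM : ∀ x, |∑ j, coordDeriv j (coordDeriv j u) x| ≤ M)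
    (x y : EuclideanSpace ℝ (Fin d)) : |u x - u y| ≤ d * M := by
  have hM0 : 0 ≤ M := (abs_nonneg _).trans (hM x)
  obtain ⟨w, hw, hw'⟩ := exists_mem_periodCell (x - y)
  have h1 : u x = u (y + w) := by
    have := hw' (fun z => u (y + z)) fun i z => by
      simp only
      rw [← add_assoc]
      exact hper i _
    simpa using this
  have h2 : ∀ S : Finset (Fin d),
      |u (y + ∑ i ∈ S, w i • EuclideanSpace.single i (1 : ℝ)) - u y| ≤ S.card * M := by
    intro S
    induction S using Finset.induction_on with
    | empty => simp
    | insert a S ha ih =>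
      rw [Finset.sum_insert ha, Finset.card_insert_of_notMem ha]
      set q := ∑ i ∈ S, w i • EuclideanSpace.single i (1 : ℝ)
      have h := hper.abs_sub_le_of_laplacian_le hu hM a
        (y + q + (w a / 2) • EuclideanSpace.single a (1 : ℝ)) (t := w a / 2)
        ⟨by linarith [(hw a).1], by linarith [(hw a).2]⟩
      have e1 : y + q + (w a / 2) • EuclideanSpace.single a (1 : ℝ)
          + (w a / 2) • EuclideanSpace.single a (1 : ℝ)
          = y + (w a • EuclideanSpace.single a (1 : ℝ) + q) := by module
      rw [e1, add_sub_cancel_right] at h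
      have h4 : M * (w a / 2 * (1 / 2 - w a / 2)) ≤ M := by
        have := (hw a).1
        have := (hw a).2
        refine mul_le_of_le_one_right hM0 ?_
        nlinarith
      have := abs_sub_le (u (y + (w a • EuclideanSpace.single a (1 : ℝ) + q))) (u (y + q)) (u y)
      push_cast
      linarith
  have h3 := h2 Finset.univ
  rw [EuclideanSpace.sum_smul_single, ← h1] at h3
  simpa using h3

end MaximumPrinciple

/-! ### Mollification of periodic functions. -/

section Mollification

variable {d : ℕ} {ρ g u w z : EuclideanSpace ℝ (Fin d) → ℝ}

/-- The convolution of `g` with a kernel `ρ`. -/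
noncomputable def mollify (ρ g : EuclideanSpace ℝ (Fin d) → ℝ) (x : EuclideanSpace ℝ (Fin d)) : ℝ :=
  ∫ t, g t * ρ (x - t)

theorem mollify_contDiff (hρ : IsTestFunction univ ρ) (hg : LocallyIntegrable g) :
    ContDiff ℝ ∞ (mollify ρ g) :=
  hρ.hasCompactSupport.contDiff_convolution_right (ContinuousLinearMap.lsmul ℝ ℝ) hg hρ.contDiff

theorem coordDeriv_mollify (hρ : IsTestFunction univ ρ) (hg : LocallyIntegrable g) (i : Fin d) :
    coordDeriv i (mollify ρ g) = mollify (coordDeriv i ρ) g := by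
  funext x
  have h1 := hρ.hasCompactSupport.hasFDerivAt_convolution_right (μ := volume)
    (ContinuousLinearMap.lsmul ℝ ℝ) hg (hρ.contDiff.of_le (by simp)) x
  have h2 := convolution_precompR_apply (μ := volume) (L := ContinuousLinearMap.lsmul ℝ ℝ) hg
    (hρ.hasCompactSupport.fderiv ℝ) (hρ.contDiff.continuous_fderiv (by simp)) x
    (EuclideanSpace.single i (1 : ℝ))
  exact (congrArg (fun L => L (EuclideanSpace.single i (1 : ℝ))) h1.fderiv).trans h2

theorem isTestFunction_comp_sub_left (hρ : IsTestFunction univ ρ)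
    (x : EuclideanSpace ℝ (Fin d)) : IsTestFunction univ (fun t => ρ (x - t)) where
  contDiff := hρ.contDiff.comp (contDiff_const.sub contDiff_id)
  hasCompactSupport := hρ.hasCompactSupport.comp_homeomorph (Homeomorph.subLeft x)
  tsupport_subset := subset_univ _

theorem coordDeriv_comp_sub_left (hρ : ContDiff ℝ ∞ ρ) (x : EuclideanSpace ℝ (Fin d))
    (i : Fin d) : coordDeriv i (fun t => ρ (x - t)) = fun t => -coordDeriv i ρ (x - t) := by
  funext t
  have h : HasFDerivAt (fun t => x - t) (-ContinuousLinearMap.id ℝ (EuclideanSpace ℝ (Fin d))) t :=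
    (hasFDerivAt_id t).const_sub x
  have := ((hρ.differentiable (by simp)) (x - t)).hasFDerivAt.comp t h
  refine (congrArg (fun L => L (EuclideanSpace.single i (1 : ℝ))) this.fderiv).trans ?_
  simp [coordDeriv]

/-- The weak derivative is tested with `t ↦ ρ (x - t)`; the sign from the chain rule cancels the one
from integration by parts. -/
theorem coordDeriv_mollify_of_isWeakDeriv (hρ : IsTestFunction univ ρ) {i : Fin d}
    (h : IsWeakDeriv univ ![i] u w) : coordDeriv i (mollify ρ u) = mollify ρ w := by
  rw [coordDeriv_mollify hρ (locallyIntegrableOn_univ.1 h.1)]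
  funext x
  have := h.3 _ (isTestFunction_comp_sub_left hρ x)
  rw [partialDeriv_one (isTestFunction_comp_sub_left hρ x).contDiff,
    coordDeriv_comp_sub_left hρ.contDiff] at this
  simp only [Measure.restrict_univ, mul_neg, integral_neg, pow_one, neg_mul, one_mul,
    neg_inj] at this
  exact this

/-- Test the lower-order identity with a derivative of `φ`; classical derivatives of `φ` commute. -/
theorem IsWeakDeriv.of_two {D : Set (EuclideanSpace ℝ (Fin d))} {i j : Fin d}
    (h : IsWeakDeriv D ![j] u w) (h' : IsWeakDeriv D ![i, j] u z) :
    IsWeakDeriv D ![i] w z := by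
  refine ⟨h.2, h'.2, fun φ hφ => ?_⟩
  have h1 := h.3 _ (hφ.coordDeriv i)
  have h2 := h'.3 _ hφ
  rw [partialDeriv_one (hφ.coordDeriv i).contDiff] at h1
  rw [partialDeriv_two hφ.contDiff, coordDeriv_comm hφ.contDiff] at h2
  rw [partialDeriv_one hφ.contDiff]
  linarith

theorem mollify_finsetSum {ι : Type*} (s : Finset ι) {f : ι → EuclideanSpace ℝ (Fin d) → ℝ}
    (hρ : IsTestFunction univ ρ) (hf : ∀ j ∈ s, LocallyIntegrable (f j))
    (x : EuclideanSpace ℝ (Fin d)) :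
    mollify ρ (fun x => ∑ j ∈ s, f j x) x = ∑ j ∈ s, mollify ρ (f j) x := by
  simp only [mollify, Finset.sum_mul]
  exact integral_finsetSum _ fun j hj => (isTestFunction_comp_sub_left hρ x).integrable_mul
    ((hf j hj).locallyIntegrableOn univ)

theorem abs_mollify_le (hρ : IsTestFunction univ ρ) (hpos : ∀ x, 0 ≤ ρ x) (hint : ∫ x, ρ x = 1)
    {M : ℝ} (hg : ∀ᵐ x, |g x| ≤ M) (x : EuclideanSpace ℝ (Fin d)) : |mollify ρ g x| ≤ M := by
  have hi : Integrable (fun t => M * ρ (x - t)) :=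
    (isTestFunction_comp_sub_left hρ x).integrable_mul
      ((locallyIntegrable_const M).locallyIntegrableOn univ)
  have h := norm_integral_le_of_norm_le (f := fun t => g t * ρ (x - t)) hi (by
    filter_upwards [hg] with t ht
    rw [Real.norm_eq_abs, abs_mul, abs_of_nonneg (hpos (x - t))]
    exact mul_le_mul_of_nonneg_right ht (hpos _))
  rw [integral_const_mul, integral_sub_left_eq_self ρ volume x, hint, mul_one] at h
  exact h

theorem isPointwisePeriodic_mollify (ρ : EuclideanSpace ℝ (Fin d) → ℝ) (hg : IsCellPeriodic g) :
    IsPointwisePeriodic (mollify ρ g) := by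
  intro i x
  unfold mollify
  rw [← integral_add_right_eq_self _ (EuclideanSpace.single i (1 : ℝ))]
  refine integral_congr_ae ?_
  filter_upwards [hg i] with t ht
  rw [ht, add_sub_add_right_eq_sub]

/-- Smooth approximations of a periodic `H²` function with bounded Laplacian, with uniform bounds
on their values, gradients and Laplacians. -/
theorem MemPeriodicH2.exists_smooth_approx {χ : EuclideanSpace ℝ (Fin d) → ℝ}
    (hχ : MemPeriodicH2 χ) {M : ℝ} (hM : ∀ᵐ y, |weakLaplacian univ χ y| ≤ M) :
    ∃ ζ : ℕ → EuclideanSpace ℝ (Fin d) → ℝ, (∀ n, ContDiff ℝ ∞ (ζ n)) ∧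
      (∃ K, ∀ n x, |ζ n x| ≤ K) ∧ (∀ n i x, |coordDeriv i (ζ n) x| ≤ M) ∧
      (∀ n x, |∑ i, coordDeriv i (coordDeriv i (ζ n)) x| ≤ M) ∧
      ∀ᵐ x, Filter.Tendsto (fun n => ζ n x) Filter.atTop (nhds (χ x)) ∧
        (∀ i, Filter.Tendsto (fun n => coordDeriv i (ζ n) x) Filter.atTop
          (nhds (weakDeriv univ ![i] χ x))) ∧
        Filter.Tendsto (fun n => ∑ i, coordDeriv i (coordDeriv i (ζ n)) x) Filter.atTop
          (nhds (weakLaplacian univ χ x)) := by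
  have hW : ∀ {k : ℕ} (_ : k ≤ 2) (s : Fin k → Fin d),
      IsWeakDeriv univ s χ (weakDeriv univ s χ) := fun hk s => by
    obtain ⟨w, hw, _⟩ := hχ.2 _ hk s
    exact hw.weakDeriv
  have hχi : LocallyIntegrable χ := locallyIntegrableOn_univ.1 (hW (Nat.zero_le 2) ![]).1
  have hLi : LocallyIntegrable (weakLaplacian univ χ) := by
    -- Every locally integrable function is its own weak derivative of order zero, so additivity of
    -- weak derivatives yields local integrability of the sum.
    have h := IsWeakDeriv.sum (D := univ) (s := ![]) Finset.univ
      (f := fun i : Fin d => weakDeriv univ ![i, i] χ) (g := fun i => weakDeriv univ ![i, i] χ)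
      fun i _ => ⟨(hW le_rfl ![i, i]).2, (hW le_rfl ![i, i]).2, by simp⟩
    exact locallyIntegrableOn_univ.1 h.1
  -- The fixed ratio 2 of outer to inner radius is what gives convergence almost everywhere for
  -- merely locally integrable functions.
  let b : ℕ → ContDiffBump (0 : EuclideanSpace ℝ (Fin d)) := fun n =>
    ⟨1 / ((n : ℝ) + 1), 2 * (1 / ((n : ℝ) + 1)), by positivity, by
      have : (0 : ℝ) < 1 / ((n : ℝ) + 1) := by positivity
      linarith⟩
  let ρ : ℕ → EuclideanSpace ℝ (Fin d) → ℝ := fun n => (b n).normed volume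
  have hρ : ∀ n, IsTestFunction univ (ρ n) := fun n =>
    ⟨(b n).contDiff_normed, (b n).hasCompactSupport_normed, subset_univ _⟩
  have hlim : ∀ {f : EuclideanSpace ℝ (Fin d) → ℝ}, LocallyIntegrable f → ∀ᵐ x,
      Filter.Tendsto (fun n => mollify (ρ n) f x) Filter.atTop (nhds (f x)) := by
    intro f hf
    have hb : Filter.Tendsto (fun n : ℕ => 2 * (1 / ((n : ℝ) + 1))) Filter.atTop (nhds 0) := by
      simpa using (tendsto_one_div_add_atTop_nhds_zero_nat (𝕜 := ℝ)).const_mul 2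
    have h := ContDiffBump.ae_convolution_tendsto_right_of_locallyIntegrable (μ := volume)
      (φ := b) (l := Filter.atTop) (K := 2)
      hb
      (Filter.Eventually.of_forall fun n => le_rfl) hf
    filter_upwards [h] with x hx
    refine hx.congr fun n => ?_
    rw [convolution_lsmul_swap]
    simp only [mollify, smul_eq_mul, mul_comm]
    rfl
  have hper : ∀ n, IsPointwisePeriodic (mollify (ρ n) χ) := fun n =>
    isPointwisePeriodic_mollify _ hχ.1
  have hsm : ∀ n, ContDiff ℝ ∞ (mollify (ρ n) χ) := fun n => mollify_contDiff (hρ n) hχi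
  have hD1 : ∀ n i, coordDeriv i (mollify (ρ n) χ) = mollify (ρ n) (weakDeriv univ ![i] χ) :=
    fun n i => coordDeriv_mollify_of_isWeakDeriv (hρ n) (hW one_le_two ![i])
  have hD2 : ∀ n x, ∑ i, coordDeriv i (coordDeriv i (mollify (ρ n) χ)) x
      = mollify (ρ n) (weakLaplacian univ χ) x := by
    intro n x
    have h := mollify_finsetSum Finset.univ (hρ n) (f := fun i : Fin d => weakDeriv univ ![i, i] χ)
      (fun i _ => locallyIntegrableOn_univ.1 (hW le_rfl ![i, i]).2) x
    refine Eq.trans (Finset.sum_congr rfl fun i _ => ?_) h.symm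
    rw [hD1, coordDeriv_mollify_of_isWeakDeriv (hρ n)
      ((hW one_le_two ![i]).of_two (hW le_rfl ![i, i]))]
  have hL : ∀ n x, |∑ i, coordDeriv i (coordDeriv i (mollify (ρ n) χ)) x| ≤ M := fun n x => by
    rw [hD2]
    exact abs_mollify_le (hρ n) (b n).nonneg_normed (b n).integral_normed hM x
  refine ⟨fun n => mollify (ρ n) χ, hsm, ?_, ?_, hL, ?_⟩
  -- Convergence at a single point bounds the values there uniformly in `n`; the oscillation bound
  -- `d * M` extends this to all points.
  · obtain ⟨y, hy⟩ := (hlim hχi).exists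
    obtain ⟨K, hK⟩ := hy.abs.bddAbove_range
    refine ⟨K + d * M, fun n x => ?_⟩
    have h1 := (hper n).abs_sub_le_card_mul (hsm n) (hL n) x y
    have h2 : |mollify (ρ n) χ y| ≤ K := hK ⟨n, rfl⟩
    have h3 := abs_sub_abs_le_abs_sub (mollify (ρ n) χ x) (mollify (ρ n) χ y)
    linarith
  · exact fun n i x => (hper n).abs_coordDeriv_le_of_laplacian_le (hsm n) (hL n) i x
  · filter_upwards [hlim hχi, ae_all_iff.2 fun i : Fin d =>
      hlim (locallyIntegrableOn_univ.1 (hW one_le_two ![i]).2), hlim hLi] with x h1 h2 h3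
    refine ⟨h1, fun i => ?_, ?_⟩
    · simp only [hD1]
      exact h2 i
    · simp only [hD2]
      exact h3

end Mollification

/-! ### Product rule with a coefficient that has bounded gradient and Laplacian. -/

section Product

variable {d : ℕ} {D : Set (EuclideanSpace ℝ (Fin d))} {i : Fin d}
  {ζ v p q φ : EuclideanSpace ℝ (Fin d) → ℝ}

theorem IsWeakDeriv.smooth_mul (hD : IsOpen D) (h : IsWeakDeriv D ![i] v p)
    (hζ : ContDiff ℝ ∞ ζ) :
    IsWeakDeriv D ![i] (fun x => ζ x * v x) (fun x => coordDeriv i ζ x * v x + ζ x * p x) := by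
  have hli : ∀ {f g : EuclideanSpace ℝ (Fin d) → ℝ}, ContDiff ℝ ∞ f → LocallyIntegrableOn g D →
      LocallyIntegrableOn (fun x => f x * g x) D := fun hf hg =>
    hg.continuousOn_mul hf.continuous.continuousOn hD.isLocallyClosed
  have h1 := hli (hζ.coordDeriv i) h.1
  have h2 := hli hζ h.2
  refine ⟨hli hζ h.1, h1.add h2, fun φ hφ => ?_⟩
  have h3 := h.3 _ (hφ.mul_left hζ)
  rw [partialDeriv_one (hφ.mul_left hζ).contDiff, coordDeriv_mul hζ hφ.contDiff] at h3
  rw [partialDeriv_one hφ.contDiff]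
  simp only [pow_one, add_mul, mul_add] at h3 ⊢
  have e1 : ∀ x, v x * (coordDeriv i ζ x * φ x) = coordDeriv i ζ x * v x * φ x :=
    fun x => by ring
  have e2 : ∀ x, v x * (ζ x * coordDeriv i φ x) = ζ x * v x * coordDeriv i φ x :=
    fun x => by ring
  have e3 : ∀ x, p x * (ζ x * φ x) = ζ x * p x * φ x := fun x => by ring
  simp only [e1, e2, e3] at h3
  rw [integral_add (hφ.integrable_mul h1).integrableOn
    ((hφ.coordDeriv i).integrable_mul (hli hζ h.1)).integrableOn] at h3
  rw [integral_add (hφ.integrable_mul h1).integrableOn (hφ.integrable_mul h2).integrableOn]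
  linarith

theorem IsWeakDeriv.two_of_one {u w z : EuclideanSpace ℝ (Fin d) → ℝ} {j : Fin d}
    (h : IsWeakDeriv D ![j] u w) (h' : IsWeakDeriv D ![i] w z) : IsWeakDeriv D ![i, j] u z := by
  refine ⟨h.1, h'.2, fun φ hφ => ?_⟩
  have h1 := h.3 _ (hφ.coordDeriv i)
  have h2 := h'.3 _ hφ
  rw [partialDeriv_one (hφ.coordDeriv i).contDiff] at h1
  rw [partialDeriv_one hφ.contDiff] at h2
  rw [partialDeriv_two hφ.contDiff, coordDeriv_comm hφ.contDiff, h1, h2]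
  ring

theorem IsWeakDeriv.smooth_mul_two (hD : IsOpen D) (h : IsWeakDeriv D ![i] v p)
    (h' : IsWeakDeriv D ![i, i] v q) (hζ : ContDiff ℝ ∞ ζ) :
    IsWeakDeriv D ![i, i] (fun x => ζ x * v x)
      (fun x => coordDeriv i (coordDeriv i ζ) x * v x + 2 * (coordDeriv i ζ x * p x)
        + ζ x * q x) := by
  have h1 := (h.smooth_mul hD (hζ.coordDeriv i)).add ((h.of_two h').smooth_mul hD hζ)
  convert (h.smooth_mul hD hζ).two_of_one h1 using 2
  ring

/-- `η` is a sequence of smooth functions that converges almost everywhere to `c₀`, together with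
its gradient, to `c₁`, and its Laplacian, to `c₂`, all being bounded by `K`. -/
structure IsSmoothApprox (η : ℕ → EuclideanSpace ℝ (Fin d) → ℝ) (K : ℝ)
    (c₀ : EuclideanSpace ℝ (Fin d) → ℝ) (c₁ : Fin d → EuclideanSpace ℝ (Fin d) → ℝ)
    (c₂ : EuclideanSpace ℝ (Fin d) → ℝ) : Prop where
  contDiff : ∀ n, ContDiff ℝ ∞ (η n)
  abs_le : ∀ n x, |η n x| ≤ K
  abs_coordDeriv_le : ∀ n i x, |coordDeriv i (η n) x| ≤ K
  abs_laplacian_le : ∀ n x, |∑ i, coordDeriv i (coordDeriv i (η n)) x| ≤ K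
  tendsto : ∀ᵐ x, Filter.Tendsto (fun n => η n x) Filter.atTop (nhds (c₀ x))
  tendsto_coordDeriv : ∀ᵐ x, ∀ i, Filter.Tendsto (fun n => coordDeriv i (η n) x) Filter.atTop
    (nhds (c₁ i x))
  tendsto_laplacian : ∀ᵐ x, Filter.Tendsto
    (fun n => ∑ i, coordDeriv i (coordDeriv i (η n)) x) Filter.atTop (nhds (c₂ x))

namespace IsSmoothApprox

variable {η : ℕ → EuclideanSpace ℝ (Fin d) → ℝ} {K : ℝ} {c₀ c₂ : EuclideanSpace ℝ (Fin d) → ℝ}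
  {c₁ : Fin d → EuclideanSpace ℝ (Fin d) → ℝ}

theorem continuous_laplacian (h : IsSmoothApprox η K c₀ c₁ c₂) (n : ℕ) :
    Continuous fun x => ∑ i, coordDeriv i (coordDeriv i (η n)) x :=
  continuous_finsetSum _ fun i _ => (((h.contDiff n).coordDeriv i).coordDeriv i).continuous

theorem ae_abs_le (h : IsSmoothApprox η K c₀ c₁ c₂) : ∀ᵐ x, |c₀ x| ≤ K := by
  filter_upwards [h.tendsto] with x hx
  exact le_of_tendsto' hx.abs fun n => h.abs_le n x

theorem ae_abs_le_one (h : IsSmoothApprox η K c₀ c₁ c₂) : ∀ᵐ x, ∀ i, |c₁ i x| ≤ K := by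
  filter_upwards [h.tendsto_coordDeriv] with x hx i
  exact le_of_tendsto' (hx i).abs fun n => h.abs_coordDeriv_le n i x

theorem aestronglyMeasurable (h : IsSmoothApprox η K c₀ c₁ c₂) : AEStronglyMeasurable c₀ :=
  aestronglyMeasurable_of_tendsto_ae _
    (fun n => (h.contDiff n).continuous.aestronglyMeasurable) h.tendsto

theorem aestronglyMeasurable_one (h : IsSmoothApprox η K c₀ c₁ c₂) (i : Fin d) :
    AEStronglyMeasurable (c₁ i) :=
  aestronglyMeasurable_of_tendsto_ae _
    (fun n => ((h.contDiff n).coordDeriv i).continuous.aestronglyMeasurable)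
    (h.tendsto_coordDeriv.mono fun _ hx => hx i)

theorem aestronglyMeasurable_two (h : IsSmoothApprox η K c₀ c₁ c₂) : AEStronglyMeasurable c₂ :=
  aestronglyMeasurable_of_tendsto_ae _
    (fun n => (h.continuous_laplacian n).aestronglyMeasurable) h.tendsto_laplacian

theorem ae_abs_le_two (h : IsSmoothApprox η K c₀ c₁ c₂) : ∀ᵐ x, |c₂ x| ≤ K := by
  filter_upwards [h.tendsto_laplacian] with x hx
  exact le_of_tendsto' hx.abs fun n => h.abs_laplacian_le n x

/-- For `r = ε⁻¹` the new bound blows up as `ε → 0`. It only feeds dominated convergence at fixed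
`ε`; the final estimate uses the bounds on `χ` and `∇χ` before scaling. -/
theorem comp_smul (h : IsSmoothApprox η K c₀ c₁ c₂) {r : ℝ} (hr : r ≠ 0) :
    IsSmoothApprox (fun n x => η n (r • x)) (K + |r| * K + r ^ 2 * K) (fun x => c₀ (r • x))
      (fun i x => r * c₁ i (r • x)) (fun x => r ^ 2 * c₂ (r • x)) := by
  have hK : 0 ≤ K := (abs_nonneg _).trans (h.abs_le 0 0)
  have hd : ∀ (i : Fin d) (f : EuclideanSpace ℝ (Fin d) → ℝ),
      coordDeriv i (fun x => f (r • x)) = fun x => r * coordDeriv i f (r • x) := by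
    intro i f
    funext x
    simp [coordDeriv, fderiv_comp_smul]
  have hd2 : ∀ (i : Fin d) (f : EuclideanSpace ℝ (Fin d) → ℝ), ContDiff ℝ ∞ f →
      coordDeriv i (coordDeriv i (fun x => f (r • x)))
        = fun x => r ^ 2 * coordDeriv i (coordDeriv i f) (r • x) := by
    intro i f hf
    rw [hd]
    funext x
    have hsm : DifferentiableAt ℝ (fun x => coordDeriv i f (r • x)) x :=
      (((hf.coordDeriv i).comp (contDiff_const_smul r)).differentiable (by simp)) x
    have h1 := congrFun (hd i (coordDeriv i f)) x
    unfold coordDeriv at h1 hsm ⊢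
    rw [fderiv_const_mul hsm]
    simp only [smul_apply, smul_eq_mul, h1]
    ring
  have hq := Measure.quasiMeasurePreserving_smul
    (volume : Measure (EuclideanSpace ℝ (Fin d))) hr
  have b1 : 0 ≤ |r| * K := by positivity
  have b2 : 0 ≤ r ^ 2 * K := by positivity
  refine ⟨fun n => (h.contDiff n).comp (contDiff_const_smul r), fun n x => ?_, fun n i x => ?_,
    fun n x => ?_, ?_, ?_, ?_⟩
  · linarith [h.abs_le n (r • x)]
  · rw [hd, abs_mul]
    linarith [mul_le_mul_of_nonneg_left (h.abs_coordDeriv_le n i (r • x)) (abs_nonneg r)]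
  · simp only [hd2 _ _ (h.contDiff n), ← Finset.mul_sum, abs_mul, abs_pow, sq_abs]
    linarith [mul_le_mul_of_nonneg_left (h.abs_laplacian_le n (r • x)) (sq_nonneg r)]
  · exact hq.ae h.tendsto
  · filter_upwards [hq.ae h.tendsto_coordDeriv] with x hx i
    simp only [hd]
    exact (hx i).const_mul r
  · filter_upwards [hq.ae h.tendsto_laplacian] with x hx
    simp only [hd2 _ _ (h.contDiff _), ← Finset.mul_sum]
    exact hx.const_mul (r ^ 2)

/-- The product rule for each smooth `η n`, followed by dominated convergence. Only the sum over `i`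
passes to the limit: the separate second derivatives of `η n` carry no uniform bound. -/
theorem integral_mul_laplacian (h : IsSmoothApprox η K c₀ c₁ c₂) (hD : IsOpen D)
    {p q : Fin d → EuclideanSpace ℝ (Fin d) → ℝ} (hv : LocallyIntegrableOn v D)
    (hp : ∀ i, IsWeakDeriv D ![i] v (p i)) (hq : ∀ i, IsWeakDeriv D ![i, i] v (q i))
    (hφ : IsTestFunction D φ) :
    ∫ x in D, c₀ x * v x * ∑ i, coordDeriv i (coordDeriv i φ) x
      = ∫ x in D, (c₂ x * v x + 2 * ∑ i, c₁ i x * p i x + c₀ x * ∑ i, q i x) * φ x := by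
  have hn : ∀ n, ∫ x in D, η n x * v x * ∑ i, coordDeriv i (coordDeriv i φ) x
      = ∫ x in D, ((∑ i, coordDeriv i (coordDeriv i (η n)) x) * v x
        + 2 * ∑ i, coordDeriv i (η n) x * p i x + η n x * ∑ i, q i x) * φ x := by
    intro n
    have hw := fun i => (hp i).smooth_mul_two hD (hq i) (h.contDiff n)
    have e : ∀ x, ((∑ i, coordDeriv i (coordDeriv i (η n)) x) * v x
        + 2 * ∑ i, coordDeriv i (η n) x * p i x + η n x * ∑ i, q i x) * φ x
        = ∑ i, (coordDeriv i (coordDeriv i (η n)) x * v x + 2 * (coordDeriv i (η n) x * p i x)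
        + η n x * q i x) * φ x := by
      intro x
      simp only [← Finset.sum_mul, Finset.sum_add_distrib, Finset.mul_sum]
    simp only [e]
    simp only [Finset.mul_sum]
    rw [integral_finsetSum, integral_finsetSum]
    · refine Finset.sum_congr rfl fun i _ => ?_
      have := (hw i).3 φ hφ
      rw [partialDeriv_two hφ.contDiff] at this
      simpa using this
    · exact fun i _ => (hφ.integrable_mul (hw i).2).integrableOn
    · exact fun i _ => (((hφ.coordDeriv i).coordDeriv i).integrable_mul (hw i).1).integrableOn
  have iv := hφ.integrable_mul hv
  have ip : ∀ i, Integrable fun x => p i x * φ x := fun i => hφ.integrable_mul (hp i).2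
  have iq : ∀ i, Integrable fun x => q i x * φ x := fun i => hφ.integrable_mul (hq i).2
  have iL : Integrable fun x => ∑ i, v x * coordDeriv i (coordDeriv i φ) x :=
    integrable_finsetSum _ fun i _ => ((hφ.coordDeriv i).coordDeriv i).integrable_mul hv
  have mv : AEStronglyMeasurable v (volume.restrict D) := hv.aestronglyMeasurable
  have mp : ∀ i, AEStronglyMeasurable (p i) (volume.restrict D) :=
    fun i => (hp i).2.aestronglyMeasurable
  have mq : ∀ i, AEStronglyMeasurable (q i) (volume.restrict D) :=
    fun i => (hq i).2.aestronglyMeasurable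
  have mφ : AEStronglyMeasurable φ (volume.restrict D) :=
    hφ.contDiff.continuous.aestronglyMeasurable
  have mη : ∀ n, AEStronglyMeasurable (η n) (volume.restrict D) :=
    fun n => (h.contDiff n).continuous.aestronglyMeasurable
  have hl : Filter.Tendsto
      (fun n => ∫ x in D, η n x * v x * ∑ i, coordDeriv i (coordDeriv i φ) x) Filter.atTop
      (nhds (∫ x in D, c₀ x * v x * ∑ i, coordDeriv i (coordDeriv i φ) x)) := by
    refine tendsto_integral_of_dominated_convergence
      (fun x => K * |∑ i, v x * coordDeriv i (coordDeriv i φ) x|) (fun n => ?_)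
      (iL.abs.const_mul K).integrableOn (fun n => ?_) ?_
    · exact ((mη n).mul mv).mul (continuous_finsetSum _ fun i _ =>
        ((hφ.contDiff.coordDeriv i).coordDeriv i).continuous).aestronglyMeasurable
    · refine Filter.Eventually.of_forall fun x => ?_
      rw [Real.norm_eq_abs, mul_assoc, abs_mul, Finset.mul_sum]
      exact mul_le_mul_of_nonneg_right (h.abs_le n x) (abs_nonneg _)
    · filter_upwards [ae_restrict_of_ae h.tendsto] with x hx
      exact (hx.mul_const _).mul_const _
  have hr : Filter.Tendsto
      (fun n => ∫ x in D, ((∑ i, coordDeriv i (coordDeriv i (η n)) x) * v x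
        + 2 * ∑ i, coordDeriv i (η n) x * p i x + η n x * ∑ i, q i x) * φ x) Filter.atTop
      (nhds (∫ x in D, (c₂ x * v x + 2 * ∑ i, c₁ i x * p i x + c₀ x * ∑ i, q i x) * φ x)) := by
    refine tendsto_integral_of_dominated_convergence
      (fun x => K * |v x * φ x| + 2 * ∑ i, K * |p i x * φ x| + K * |∑ i, q i x * φ x|)
      (fun n => ?_) ?_ (fun n => ?_) ?_
    · refine AEStronglyMeasurable.mul (AEStronglyMeasurable.add (AEStronglyMeasurable.add
        ((h.continuous_laplacian n).aestronglyMeasurable.mul mv) ?_) ((mη n).mul ?_)) mφ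
      · exact (Finset.aestronglyMeasurable_fun_sum _ fun i _ =>
          ((h.contDiff n).coordDeriv i).continuous.aestronglyMeasurable.mul (mp i)).const_mul 2
      · exact Finset.aestronglyMeasurable_fun_sum _ fun i _ => mq i
    · exact ((iv.abs.const_mul K).add ((integrable_finsetSum _ fun i _ =>
        (ip i).abs.const_mul K).const_mul 2)).add
        ((integrable_finsetSum _ fun i _ => iq i).abs.const_mul K) |>.integrableOn
    · refine Filter.Eventually.of_forall fun x => ?_
      rw [Real.norm_eq_abs, add_mul, add_mul]
      refine (abs_add_le _ _).trans (add_le_add ((abs_add_le _ _).trans (add_le_add ?_ ?_)) ?_)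
      · rw [mul_assoc, abs_mul]
        exact mul_le_mul_of_nonneg_right (h.abs_laplacian_le n x) (abs_nonneg _)
      · rw [mul_assoc, abs_mul, abs_two, Finset.sum_mul]
        refine mul_le_mul_of_nonneg_left ((Finset.abs_sum_le_sum_abs _ _).trans
          (Finset.sum_le_sum fun i _ => ?_)) zero_le_two
        rw [mul_assoc, abs_mul]
        exact mul_le_mul_of_nonneg_right (h.abs_coordDeriv_le n i x) (abs_nonneg _)
      · rw [mul_assoc, abs_mul, Finset.sum_mul]
        exact mul_le_mul_of_nonneg_right (h.abs_le n x) (abs_nonneg _)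
    · filter_upwards [ae_restrict_of_ae h.tendsto, ae_restrict_of_ae h.tendsto_coordDeriv,
        ae_restrict_of_ae h.tendsto_laplacian] with x h0 h1 h2
      exact (((h2.mul_const _).add ((tendsto_finsetSum _ fun i _ =>
        (h1 i).mul_const _).const_mul 2)).add (h0.mul_const _)).mul_const _
  exact tendsto_nhds_unique (hl.congr hn) hr

theorem memLp_mul {c f : EuclideanSpace ℝ (Fin d) → ℝ} (hc : AEStronglyMeasurable c)
    (hK : ∀ᵐ x, |c x| ≤ K) (hf : MemLp f 2 (volume.restrict D)) :
    MemLp (fun x => c x * f x) 2 (volume.restrict D) := by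
  refine hf.of_le_mul (c := K) (hc.restrict.mul hf.1) ?_
  filter_upwards [ae_restrict_of_ae hK] with x hx
  rw [norm_mul]
  exact mul_le_mul_of_nonneg_right hx (norm_nonneg _)

/-- Membership of the product in `H²` is a hypothesis because the bounds control only the Laplacian
of the coefficient, not its separate second derivatives. Given it, the distributional identity
determines the Laplacian. -/
theorem weakLaplacian_mul (h : IsSmoothApprox η K c₀ c₁ c₂) (hD : IsOpen D)
    {p q : Fin d → EuclideanSpace ℝ (Fin d) → ℝ} (hv : MemLp v 2 (volume.restrict D))
    (hp : ∀ i, IsWeakDeriv D ![i] v (p i)) (hp' : ∀ i, MemLp (p i) 2 (volume.restrict D))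
    (hq : ∀ i, IsWeakDeriv D ![i, i] v (q i)) (hq' : ∀ i, MemLp (q i) 2 (volume.restrict D))
    (hm : MemSobolev 2 D fun x => c₀ x * v x) :
    weakLaplacian D (fun x => c₀ x * v x) =ᵐ[volume.restrict D]
      fun x => c₂ x * v x + 2 * ∑ i, c₁ i x * p i x + c₀ x * ∑ i, q i x := by
  have hli : ∀ {f : EuclideanSpace ℝ (Fin d) → ℝ}, MemLp f 2 (volume.restrict D) →
      LocallyIntegrableOn f D := fun hf =>
    locallyIntegrableOn_of_locallyIntegrable_restrict (hf.locallyIntegrable (by norm_num))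
  refine ae_eq_of_integral_mul_test_eq hD (hli (hm.memLp_weakLaplacian hD le_rfl)) (hli ?_)
    fun φ hφ => ?_
  · refine ((memLp_mul h.aestronglyMeasurable_two h.ae_abs_le_two hv).add
      (MemLp.const_mul ?_ 2)).add (memLp_mul h.aestronglyMeasurable h.ae_abs_le ?_)
    · exact memLp_finsetSum _ fun i _ => memLp_mul (h.aestronglyMeasurable_one i)
        (h.ae_abs_le_one.mono fun x hx => hx i) (hp' i)
    · exact memLp_finsetSum _ fun i _ => hq' i
  · rw [← hm.integral_mul_laplacian hφ]
    exact h.integral_mul_laplacian hD (hli hv) hp hq hφ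

end IsSmoothApprox

theorem MemPeriodicH2.exists_isSmoothApprox {χ : EuclideanSpace ℝ (Fin d) → ℝ}
    (hχ : MemPeriodicH2 χ) {M : ℝ} (hM : ∀ᵐ y, |weakLaplacian univ χ y| ≤ M) :
    ∃ ζ K, IsSmoothApprox ζ K χ (fun i => weakDeriv univ ![i] χ) (weakLaplacian univ χ) := by
  obtain ⟨ζ, h1, ⟨K, h2⟩, h3, h4, h5⟩ := hχ.exists_smooth_approx hM
  exact ⟨ζ, max K M, h1, fun n x => (h2 n x).trans (le_max_left _ _),
    fun n i x => (h3 n i x).trans (le_max_right _ _),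
    fun n x => (h4 n x).trans (le_max_right _ _), h5.mono fun _ h => h.1,
    h5.mono fun _ h => h.2.1, h5.mono fun _ h => h.2.2⟩

end Product

/-! ### Derivatives of `(Δ + τ)u₀`, the energy form and coercivity. -/

section Energy

variable {d : ℕ} {D : Set (EuclideanSpace ℝ (Fin d))} {u : EuclideanSpace ℝ (Fin d) → ℝ}

theorem IsWeakDeriv.of_three {w z : EuclideanSpace ℝ (Fin d) → ℝ} {i j l : Fin d}
    (h : IsWeakDeriv D ![j, l] u w) (h' : IsWeakDeriv D ![i, j, l] u z) :
    IsWeakDeriv D ![i] w z := by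
  refine ⟨h.2, h'.2, fun φ hφ => ?_⟩
  have hs := hφ.contDiff
  have h1 := h.3 _ (hφ.coordDeriv i)
  have h2 := h'.3 _ hφ
  rw [partialDeriv_two (hs.coordDeriv i), coordDeriv_comm hs l i,
    coordDeriv_comm (hs.coordDeriv l) j i] at h1
  rw [partialDeriv_three hs] at h2
  rw [partialDeriv_one hs]
  linarith

theorem IsWeakDeriv.of_four {w z : EuclideanSpace ℝ (Fin d) → ℝ} {i j l m : Fin d}
    (h : IsWeakDeriv D ![l, m] u w) (h' : IsWeakDeriv D ![i, j, l, m] u z) :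
    IsWeakDeriv D ![i, j] w z := by
  refine ⟨h.2, h'.2, fun φ hφ => ?_⟩
  have hs := hφ.contDiff
  have h1 := h.3 _ ((hφ.coordDeriv j).coordDeriv i)
  have h2 := h'.3 _ hφ
  rw [partialDeriv_two ((hs.coordDeriv j).coordDeriv i), coordDeriv_comm (hs.coordDeriv j) m i,
    coordDeriv_comm hs m j, coordDeriv_comm ((hs.coordDeriv m).coordDeriv j) l i,
    coordDeriv_comm (hs.coordDeriv m) l j] at h1
  rw [partialDeriv_four hs] at h2
  rw [partialDeriv_two hs]
  linarith

namespace MemSobolev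

theorem isWeakDeriv_one_helmholtz (hu : MemSobolev 4 D u) (τ : ℝ) (i : Fin d) :
    IsWeakDeriv D ![i] (fun x => weakLaplacian D u x + τ * u x)
      (fun x => ∑ j, weakDeriv D ![i, j, j] u x + τ * weakDeriv D ![i] u x) :=
  (IsWeakDeriv.sum Finset.univ fun j _ => (hu.isWeakDeriv (by norm_num) ![j, j]).of_three
    (hu.isWeakDeriv (by norm_num) ![i, j, j])).add
    ((hu.isWeakDeriv (by norm_num) ![i]).const_mul τ)

theorem isWeakDeriv_two_helmholtz (hu : MemSobolev 4 D u) (τ : ℝ) (i : Fin d) :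
    IsWeakDeriv D ![i, i] (fun x => weakLaplacian D u x + τ * u x)
      (fun x => ∑ j, weakDeriv D ![i, i, j, j] u x + τ * weakDeriv D ![i, i] u x) :=
  (IsWeakDeriv.sum Finset.univ fun j _ => (hu.isWeakDeriv (by norm_num) ![j, j]).of_four
    (hu.isWeakDeriv (by norm_num) ![i, i, j, j])).add
    ((hu.isWeakDeriv (by norm_num) ![i, i]).const_mul τ)

theorem memLp_helmholtz {m : ℕ} (hD : IsOpen D) (hu : MemSobolev m D u) (hm : 2 ≤ m) (τ : ℝ) :
    MemLp (fun x => weakLaplacian D u x + τ * u x) 2 (volume.restrict D) :=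
  (hu.memLp_weakLaplacian hD hm).add (hu.1.const_mul τ)

theorem abs_weakDeriv_le_sqrt_sum {m k : ℕ} (D : Set (EuclideanSpace ℝ (Fin d)))
    (u : EuclideanSpace ℝ (Fin d) → ℝ) (hk : k ≤ m) (s : Fin k → Fin d)
    (x : EuclideanSpace ℝ (Fin d)) : |weakDeriv D s u x| ≤
      Real.sqrt (∑ k ∈ Finset.range (m + 1), ∑ i : Fin k → Fin d, weakDeriv D i u x ^ 2) := by
  refine Real.abs_le_sqrt ?_
  have h1 := Finset.single_le_sum (f := fun i : Fin k → Fin d => weakDeriv D i u x ^ 2)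
    (fun _ _ => sq_nonneg _) (Finset.mem_univ s)
  have h2 := Finset.single_le_sum
    (f := fun k => ∑ i : Fin k → Fin d, weakDeriv D i u x ^ 2)
    (fun _ _ => Finset.sum_nonneg fun _ _ => sq_nonneg _)
    (Finset.mem_range.2 (Nat.lt_succ_of_le hk))
  exact h1.trans h2

end MemSobolev

theorem abs_sum_add_mul_le {f : Fin d → ℝ} {g τ S : ℝ} (hτ : 0 ≤ τ) (hf : ∀ j, |f j| ≤ S)
    (hg : |g| ≤ S) : |∑ j, f j + τ * g| ≤ (d + τ) * S := by
  have h1 : |∑ j, f j| ≤ d * S :=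
    (Finset.abs_sum_le_sum_abs _ _).trans
      ((Finset.sum_le_card_nsmul _ _ S fun j _ => hf j).trans (by simp))
  have h2 : |τ * g| ≤ τ * S := by
    rw [abs_mul, abs_of_nonneg hτ]
    exact mul_le_mul_of_nonneg_left hg hτ
  linarith [abs_add_le (∑ j, f j) (τ * g)]

theorem integrable_mul_mul {b f g : EuclideanSpace ℝ (Fin d) → ℝ} {K : ℝ}
    (hb : AEStronglyMeasurable b) (hK : ∀ᵐ x, |b x| ≤ K) (hf : MemLp f 2 (volume.restrict D))
    (hg : MemLp g 2 (volume.restrict D)) :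
    Integrable (fun x => b x * f x * g x) (volume.restrict D) :=
  (IsSmoothApprox.memLp_mul hb hK hf).integrable_mul hg

theorem integrable_fourthOrderForm {b w : EuclideanSpace ℝ (Fin d) → ℝ} {K : ℝ} (hD : IsOpen D)
    (hb : AEStronglyMeasurable b) (hK : ∀ᵐ x, |b x| ≤ K) (τ : ℝ) (hu : MemSobolev 2 D u)
    (hw : MemSobolev 2 D w) :
    Integrable (fun x => b x * (weakLaplacian D u x + τ * u x) * (weakLaplacian D w x + τ * w x)
      + τ ^ 2 * (u x * w x)) (volume.restrict D) :=
  (integrable_mul_mul hb hK (hu.memLp_helmholtz hD le_rfl τ)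
    (hw.memLp_helmholtz hD le_rfl τ)).add ((hu.1.integrable_mul hw.1).const_mul _)

theorem fourthOrderForm_eq_integral {b w : EuclideanSpace ℝ (Fin d) → ℝ} {K : ℝ} (hD : IsOpen D)
    (hb : AEStronglyMeasurable b) (hK : ∀ᵐ x, |b x| ≤ K) (τ : ℝ) (hu : MemSobolev 2 D u)
    (hw : MemSobolev 2 D w) :
    fourthOrderForm D b τ u w = ∫ x in D, (b x * (weakLaplacian D u x + τ * u x)
      * (weakLaplacian D w x + τ * w x) + τ ^ 2 * (u x * w x)) := by
  have h : Integrable (fun x => τ ^ 2 * (u x * w x)) (volume.restrict D) :=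
    (hu.1.integrable_mul hw.1).const_mul _
  rw [fourthOrderForm, integral_add (integrable_mul_mul hb hK (hu.memLp_helmholtz hD le_rfl τ)
    (hw.memLp_helmholtz hD le_rfl τ)) h, integral_const_mul]

/-- Pointwise form of the coercivity estimate. -/
theorem sq_sub_le_of_energy {b a₀ a₁ τ P W R r B S : ℝ} (ha₀ : 0 < a₀) (hb₀ : a₀ ≤ b)
    (hb₁ : b ≤ a₁) (hR : |R| ≤ B * S) (hr : |r| ≤ B * S) :
    (P - τ * W) ^ 2 ≤ (2 / a₀ + 2) * (2 * (b * P * (P + R) + τ ^ 2 * (W * (W + r)))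
      + (a₁ + τ ^ 2) * B ^ 2 * S ^ 2) := by
  have hb : 0 < b := ha₀.trans_le hb₀
  have h1 : R ^ 2 ≤ B ^ 2 * S ^ 2 := by
    rw [← mul_pow]
    exact sq_le_sq' (abs_le.1 hR).1 (abs_le.1 hR).2
  have h2 : r ^ 2 ≤ B ^ 2 * S ^ 2 := by
    rw [← mul_pow]
    exact sq_le_sq' (abs_le.1 hr).1 (abs_le.1 hr).2
  have h3 : b * R ^ 2 ≤ a₁ * (B ^ 2 * S ^ 2) :=
    mul_le_mul hb₁ h1 (sq_nonneg _) (hb.le.trans hb₁)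
  have h4 : τ ^ 2 * r ^ 2 ≤ τ ^ 2 * (B ^ 2 * S ^ 2) :=
    mul_le_mul_of_nonneg_left h2 (sq_nonneg _)
  -- From `2P(P + R) = P² + (P + R)² - R²` and the same identity for `W` and `r`, dropping the
  -- middle squares.
  have h5 : b * P ^ 2 + τ ^ 2 * W ^ 2 ≤ 2 * (b * P * (P + R) + τ ^ 2 * (W * (W + r)))
      + (a₁ + τ ^ 2) * B ^ 2 * S ^ 2 := by
    have h6 := mul_nonneg hb.le (sq_nonneg (P + R))
    have h7 := sq_nonneg (τ * (W + r))
    nlinarith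
  -- `(P - τW)² ≤ 2P² + 2τ²W²`; the lower bound on `b` absorbs the first term.
  have h8 : (P - τ * W) ^ 2 ≤ (2 / a₀ + 2) * (b * P ^ 2 + τ ^ 2 * W ^ 2) := by
    have h9 : 2 * P ^ 2 ≤ 2 / a₀ * (b * P ^ 2) := by
      rw [div_mul_eq_mul_div, le_div_iff₀ ha₀]
      nlinarith [mul_le_mul_of_nonneg_right hb₀ (sq_nonneg P)]
    have h10 : 0 ≤ 2 / a₀ * (τ ^ 2 * W ^ 2) := by positivity
    have h11 : 0 ≤ b * P ^ 2 := by positivity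
    nlinarith [sq_nonneg (P + τ * W)]
  exact h8.trans (mul_le_mul_of_nonneg_left h5 (by positivity))

end Energy

/-! ### The error estimate. -/

theorem mainTheorem6 {d : ℕ} (hd : d = 2 ∨ d = 3)
    (D : Set (EuclideanSpace ℝ (Fin d))) (hD : IsC2Domain D)
    (a : EuclideanSpace ℝ (Fin d) → ℝ) (ha_meas : AEMeasurable a MeasureTheory.volume)
    (ha_per : IsCellPeriodic a)
    (a₀ a₁ : ℝ) (ha₀ : 0 < a₀) (ha_bdd : ∀ᵐ y, a₀ ≤ a y ∧ a y ≤ a₁)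
    (τ : ℝ) (hτ : 0 < τ)
    (χ : EuclideanSpace ℝ (Fin d) → ℝ) (hχ : IsCellFunction a χ) :
    ∃ C : ℝ, 0 < C ∧ ∀ ε : ℝ, 0 < ε → ε ≤ 1 →
      ∀ h : (EuclideanSpace ℝ (Fin d) → ℝ) → ℝ, MemHNegTwo D h →
      ∀ uε u₀ θ : EuclideanSpace ℝ (Fin d) → ℝ,
        IsH20Solution D (fun x => a (ε⁻¹ • x)) τ h uε →
        IsH20Solution D (fun _ => homogenizedCoeff a) τ h u₀ →
        MemSobolev 4 D u₀ →
        IsDirichletSolution D (fun x => a (ε⁻¹ • x)) τ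
          (fun x => -ε * bulkCorrector D χ τ ε u₀ x) θ →
        MemH20 D
          (fun x => uε x - (u₀ x + ε ^ 2 * bulkCorrector D χ τ ε u₀ x + ε * θ x)) ∧
        normH20 D
          (fun x => uε x - (u₀ x + ε ^ 2 * bulkCorrector D χ τ ε u₀ x + ε * θ x))
            ≤ C * ε * sobolevNorm 4 D u₀ := by
  have hDo := hD.isOpen
  set A := homogenizedCoeff a with hA
  have hM : ∀ᵐ y, |weakLaplacian univ χ y| ≤ |A| / a₀ + 1 := by
    filter_upwards [hχ.laplacian_eq, ha_bdd] with y hy hay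
    rw [hy]
    refine (abs_sub _ _).trans (add_le_add ?_ (by simp))
    rw [abs_div, abs_of_pos (ha₀.trans_le hay.1)]
    exact div_le_div_of_nonneg_left (abs_nonneg _) ha₀ hay.1
  obtain ⟨ζ, K, hζ⟩ := hχ.memPeriodicH2.exists_isSmoothApprox hM
  have hK : 0 ≤ K := (abs_nonneg _).trans (hζ.abs_le 0 0)
  have ha₁ : 0 ≤ a₁ := by
    obtain ⟨y, hy⟩ := ha_bdd.exists
    linarith
  -- `d + τ` bounds `v`, `∇v` and each `∂ᵢᵢv` by derivatives of `u₀`. In the other factor `2d` comes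
  -- from `2∇χ·∇v`, `d + τ` from `χ(Δ + τ)v` and `1` from `r`.
  set B := K * ((d + τ) * (3 * d + τ + 1)) with hB
  have hB0 : 0 ≤ B := by positivity
  refine ⟨Real.sqrt ((2 / a₀ + 2) * (a₁ + τ ^ 2)) * B + 1, by positivity, ?_⟩
  intro ε hε hε1 h _ uε u₀ θ huε hu₀ hu₀4 hθ
  set β := bulkCorrector D χ τ ε u₀ with hβ
  set W : EuclideanSpace ℝ (Fin d) → ℝ := fun x => uε x - (u₀ x + ε ^ 2 * β x + ε * θ x) with hW
  have hWH : MemH20 D W := by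
    -- `W = uε - u₀ - ε(θ + εβ)`, and the boundary condition on `θ` puts the bracket in `H²₀`.
    have := (huε.1.sub hDo hu₀.1).sub hDo (hθ.boundary.const_mul hDo ε)
    convert this using 1
    funext x
    simp only [hW]
    ring
  refine ⟨hWH, ?_⟩
  have hβS : MemSobolev 2 D β := by
    -- `H²` regularity of `β` is read off from `θ` and `θ + εβ`, both in `H²`, so the product
    -- `χ(·/ε)v` needs no separate argument.
    have := (hθ.memSobolev.sub hθ.boundary.1).const_mul (-ε)⁻¹
    convert this using 1
    funext x
    field_simp
    ring
  have hε0 : ε⁻¹ ≠ 0 := inv_ne_zero hε.ne'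
  have hq := Measure.quasiMeasurePreserving_smul
    (volume : Measure (EuclideanSpace ℝ (Fin d))) hε0
  set b : EuclideanSpace ℝ (Fin d) → ℝ := fun x => a (ε⁻¹ • x) with hb
  have hb_meas : AEStronglyMeasurable b :=
    ha_meas.aestronglyMeasurable.comp_quasiMeasurePreserving hq
  have hb_bdd : ∀ᵐ x, a₀ ≤ b x ∧ b x ≤ a₁ := hq.ae ha_bdd
  have hb_abs : ∀ᵐ x, |b x| ≤ a₁ := hb_bdd.mono fun x hx => by
    rw [abs_of_pos (ha₀.trans_le hx.1)]
    exact hx.2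
  set v : EuclideanSpace ℝ (Fin d) → ℝ := fun x => weakLaplacian D u₀ x + τ * u₀ x with hv
  set p : Fin d → EuclideanSpace ℝ (Fin d) → ℝ := fun i x =>
    ∑ j, weakDeriv D ![i, j, j] u₀ x + τ * weakDeriv D ![i] u₀ x with hp
  set q : Fin d → EuclideanSpace ℝ (Fin d) → ℝ := fun i x =>
    ∑ j, weakDeriv D ![i, i, j, j] u₀ x + τ * weakDeriv D ![i, i] u₀ x with hq_def
  set T : EuclideanSpace ℝ (Fin d) → ℝ := fun x =>
    ∑ k ∈ Finset.range (4 + 1), ∑ i : Fin k → Fin d, weakDeriv D i u₀ x ^ 2 with hT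
  have hT0 : ∀ x, 0 ≤ T x := fun x =>
    Finset.sum_nonneg fun _ _ => Finset.sum_nonneg fun _ _ => sq_nonneg _
  have hlapβ := (hζ.comp_smul hε0).weakLaplacian_mul hDo (v := v) (p := p) (q := q)
    (hu₀4.memLp_helmholtz hDo (by norm_num) τ) (hu₀4.isWeakDeriv_one_helmholtz τ)
    (fun i => (memLp_finsetSum _ fun j _ => hu₀4.memLp_weakDeriv hDo (by norm_num) _).add
      ((hu₀4.memLp_weakDeriv hDo (by norm_num) _).const_mul τ))
    (hu₀4.isWeakDeriv_two_helmholtz τ)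
    (fun i => (memLp_finsetSum _ fun j _ => hu₀4.memLp_weakDeriv hDo (by norm_num) _).add
      ((hu₀4.memLp_weakDeriv hDo (by norm_num) _).const_mul τ)) hβS
  change weakLaplacian D β =ᵐ[volume.restrict D] _ at hlapβ
  have hlapW : weakLaplacian D W =ᵐ[volume.restrict D] fun x =>
      weakLaplacian D uε x - (weakLaplacian D u₀ x + ε ^ 2 * weakLaplacian D β x
        + ε * weakLaplacian D θ x) := by
    have hβ' := hβS.const_mul (ε ^ 2)
    have hθ' := hθ.memSobolev.const_mul ε
    filter_upwards [huε.1.1.weakLaplacian_sub hDo ((hu₀.1.1.add hβ').add hθ'),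
      (hu₀.1.1.add hβ').weakLaplacian_add hDo hθ', hu₀.1.1.weakLaplacian_add hDo hβ',
      hβS.weakLaplacian_const_mul hDo (ε ^ 2), hθ.memSobolev.weakLaplacian_const_mul hDo ε]
      with x h1 h2 h3 h4 h5
    rw [h1, h2, h3, h4, h5]
  have hconst : ∀ᵐ x : EuclideanSpace ℝ (Fin d), |A| ≤ |A| := Filter.Eventually.of_forall
    fun _ => le_rfl
  let F : (EuclideanSpace ℝ (Fin d) → ℝ) → (EuclideanSpace ℝ (Fin d) → ℝ) →
      EuclideanSpace ℝ (Fin d) → ℝ := fun c f x =>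
    c x * (weakLaplacian D f x + τ * f x) * (weakLaplacian D W x + τ * W x)
      + τ ^ 2 * (f x * W x)
  have i1 : Integrable (F b uε) (volume.restrict D) :=
    integrable_fourthOrderForm hDo hb_meas hb_abs τ huε.1.1 hWH.1
  have i2 : Integrable (F (fun _ => A) u₀) (volume.restrict D) :=
    integrable_fourthOrderForm hDo aestronglyMeasurable_const hconst τ hu₀.1.1 hWH.1
  have i3 : Integrable (F b θ) (volume.restrict D) :=
    integrable_fourthOrderForm hDo hb_meas hb_abs τ hθ.memSobolev hWH.1
  have e1 : ∫ x in D, F b uε x = h W :=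
    (fourthOrderForm_eq_integral hDo hb_meas hb_abs τ huε.1.1 hWH.1).symm.trans (huε.2 W hWH)
  have e2 : ∫ x in D, F (fun _ => A) u₀ x = h W :=
    (fourthOrderForm_eq_integral hDo aestronglyMeasurable_const hconst τ hu₀.1.1
      hWH.1).symm.trans (hu₀.2 W hWH)
  have e3 : ∫ x in D, F b θ x = 0 :=
    (fourthOrderForm_eq_integral hDo hb_meas hb_abs τ hθ.memSobolev hWH.1).symm.trans
      (hθ.equation W hWH)
  have i12 : Integrable (fun x => F b uε x - F (fun _ => A) u₀ x) (volume.restrict D) := i1.sub i2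
  have i4 : Integrable (fun x => F b uε x - F (fun _ => A) u₀ x - ε * F b θ x)
    (volume.restrict D) := i12.sub (i3.const_mul ε)
  -- The three equations are tested with the error itself, and the two values of `h` cancel.
  have e4 : ∫ x in D, (F b uε x - F (fun _ => A) u₀ x - ε * F b θ x) = 0 := by
    rw [integral_sub i12 (i3.const_mul ε), integral_sub i1 i2, integral_const_mul,
      e1, e2, e3]
    ring
  have iT : Integrable T (volume.restrict D) := hu₀4.integrable_sum_sq_weakDeriv hDo
  have key : ∀ᵐ x ∂volume.restrict D, weakLaplacian D W x ^ 2 ≤ (2 / a₀ + 2) *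
      (2 * (F b uε x - F (fun _ => A) u₀ x - ε * F b θ x)
        + (a₁ + τ ^ 2) * (B * ε) ^ 2 * T x) := by
    -- The order-zero term of the Sobolev norm contains a chosen representative, equal to `u₀` only
    -- almost everywhere.
    have hu₀0 := (hu₀4.isWeakDeriv (Nat.zero_le 4) ![]).ae_eq hDo
      (z := u₀) ⟨(hu₀4.isWeakDeriv (Nat.zero_le 4) ![]).1,
        (hu₀4.isWeakDeriv (Nat.zero_le 4) ![]).1, by simp⟩
    filter_upwards [hlapβ, hlapW, hu₀0, ae_restrict_of_ae hb_bdd,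
      ae_restrict_of_ae (hq.ae hχ.laplacian_eq), ae_restrict_of_ae (hq.ae hζ.ae_abs_le),
      ae_restrict_of_ae (hq.ae hζ.ae_abs_le_one)] with x hLβ hLW hu0 hbx hLχ hχx hwx
    set S := Real.sqrt (T x) with hS
    have hS0 : 0 ≤ S := Real.sqrt_nonneg _
    have hST : S ^ 2 = T x := Real.sq_sqrt (hT0 x)
    have hder : ∀ {k : ℕ} (_ : k ≤ 4) (s : Fin k → Fin d), |weakDeriv D s u₀ x| ≤ S :=
      fun hk s => MemSobolev.abs_weakDeriv_le_sqrt_sum D u₀ hk s x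
    have hvx : |v x| ≤ (d + τ) * S :=
      abs_sum_add_mul_le hτ.le (fun j => hder (by norm_num) _)
        (by rw [← hu0]; exact hder (Nat.zero_le 4) _)
    have hpx : ∀ i, |p i x| ≤ (d + τ) * S := fun i =>
      abs_sum_add_mul_le hτ.le (fun j => hder (by norm_num) _) (hder (by norm_num) _)
    have hqx : ∀ i, |q i x| ≤ (d + τ) * S := fun i =>
      abs_sum_add_mul_le hτ.le (fun j => hder (by norm_num) _) (hder (by norm_num) _)
    set c := χ (ε⁻¹ • x) with hc
    set w : Fin d → ℝ := fun i => weakDeriv univ ![i] χ (ε⁻¹ • x) with hw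
    -- What remains of `ε²(Δ + τ)β` once the term with `Δχ` is removed.
    set R := 2 * ε * ∑ i, w i * p i x + ε ^ 2 * (c * (∑ i, q i x + τ * v x)) with hR
    set r := ε ^ 2 * β x with hr
    have hβx : β x = c * v x := rfl
    set E := (d + τ) * S with hE
    have hE0 : 0 ≤ E := by positivity
    have hε2 : ε ^ 2 ≤ ε := by nlinarith
    have hrx : |r| ≤ B * ε * S := by
      have h1 : |r| ≤ ε * (K * E) := by
        rw [hr, hβx, abs_mul, abs_mul, abs_of_nonneg (sq_nonneg ε)]
        exact mul_le_mul hε2 (mul_le_mul hχx hvx (abs_nonneg _) hK) (by positivity) hε.le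
      have h2 : 0 ≤ ε * (K * E) * (3 * d + τ) := by positivity
      have h3 : B * ε * S = ε * (K * E) + ε * (K * E) * (3 * d + τ) := by
        rw [hB, hE]; ring
      linarith
    have hRx : |R| ≤ B * ε * S := by
      have h1 : |∑ i, w i * p i x| ≤ d * (K * E) :=
        (Finset.abs_sum_le_sum_abs _ _).trans
          ((Finset.sum_le_card_nsmul _ _ (K * E) fun i _ => by
            rw [abs_mul]
            exact mul_le_mul (hwx i) (hpx i) (abs_nonneg _) hK).trans (by simp))
      have h2 : |c * (∑ i, q i x + τ * v x)| ≤ K * ((d + τ) * E) := by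
        rw [abs_mul]
        exact mul_le_mul hχx (abs_sum_add_mul_le hτ.le hqx hvx) (abs_nonneg _) hK
      have h3 : |R| ≤ 2 * ε * (d * (K * E)) + ε * (K * ((d + τ) * E)) := by
        refine (abs_add_le _ _).trans (add_le_add ?_ ?_)
        · rw [abs_mul, abs_of_nonneg (by positivity : 0 ≤ 2 * ε)]
          exact mul_le_mul_of_nonneg_left h1 (by positivity)
        · rw [abs_mul, abs_of_nonneg (sq_nonneg ε)]
          exact mul_le_mul hε2 h2 (abs_nonneg _) hε.le
      have h4 : 0 ≤ ε * (K * E) := by positivity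
      have h5 : B * ε * S
          = 2 * ε * (d * (K * E)) + ε * (K * ((d + τ) * E)) + ε * (K * E) := by
        rw [hB, hE]; ring
      linarith
    set P := weakLaplacian D W x + τ * W x with hP
    have hbx0 : b x ≠ 0 := (ha₀.trans_le hbx.1).ne'
    -- The factor `ε⁻²` from differentiating `χ(·/ε)` twice cancels `ε²`, and the cell equation
    -- supplies `A / b - 1`.
    have hLβ' : ε ^ 2 * (weakLaplacian D β x + τ * β x) = (A / b x - 1) * v x + R := by
      rw [hLβ, hLχ, hβx, hR]
      simp only [mul_assoc, ← Finset.mul_sum]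
      change ε ^ 2 * (ε⁻¹ ^ 2 * ((A / b x - 1) * v x) + 2 * (ε⁻¹ * ∑ i, w i * p i x)
        + c * ∑ i, q i x + τ * (c * v x)) = _
      field_simp
      ring
    have hPR : P + R = weakLaplacian D uε x + τ * uε x - A / b x * v x
        - ε * (weakLaplacian D θ x + τ * θ x) := by
      have hR' : R = ε ^ 2 * (weakLaplacian D β x + τ * β x) - (A / b x - 1) * v x := by
        linarith
      rw [hR', hP, hLW]
      simp only [hW, hv]
      ring
    have hWr : W x + r = uε x - u₀ x - ε * θ x := by
      simp only [hW, hr]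
      ring
    -- Here `b · (A / b) = A` matches the oscillating flux with the homogenized one.
    have hF : F b uε x - F (fun _ => A) u₀ x - ε * F b θ x
        = b x * P * (P + R) + τ ^ 2 * (W x * (W x + r)) := by
      rw [hPR, hWr]
      have h1 : b x * (A / b x * v x) = A * v x := by
        field_simp
      have h2 : b x * P * (weakLaplacian D uε x + τ * uε x - A / b x * v x
          - ε * (weakLaplacian D θ x + τ * θ x)) = b x * P * (weakLaplacian D uε x + τ * uε x)
          - P * (b x * (A / b x * v x)) - ε * (b x * P * (weakLaplacian D θ x + τ * θ x)) := by
        ring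
      rw [h2, h1]
      simp only [F, hv, ← hP]
      ring
    have := sq_sub_le_of_energy (τ := τ) (P := P) (W := W x) ha₀ hbx.1 hbx.2 hRx hrx
    rw [hF, ← hST]
    refine le_trans (le_of_eq ?_) this
    rw [hP]
    ring
  have hint : ∫ x in D, weakLaplacian D W x ^ 2
      ≤ (2 / a₀ + 2) * (a₁ + τ ^ 2) * (B * ε * sobolevNorm 4 D u₀) ^ 2 := by
    have i5 := ((i4.const_mul 2).add (iT.const_mul ((a₁ + τ ^ 2) * (B * ε) ^ 2))).const_mul
      (2 / a₀ + 2)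
    refine (integral_mono_ae (hWH.1.memLp_weakLaplacian hDo le_rfl).integrable_sq i5 key).trans
      (le_of_eq ?_)
    simp only [Pi.add_apply]
    rw [integral_const_mul, integral_add (i4.const_mul 2)
      (iT.const_mul ((a₁ + τ ^ 2) * (B * ε) ^ 2)), integral_const_mul, integral_const_mul]
    rw [e4, hu₀4.integral_sum_sq_weakDeriv hDo]
    ring
  have hN : 0 ≤ sobolevNorm 4 D u₀ := Real.sqrt_nonneg _
  calc normH20 D W ≤ Real.sqrt ((2 / a₀ + 2) * (a₁ + τ ^ 2)
        * (B * ε * sobolevNorm 4 D u₀) ^ 2) := Real.sqrt_le_sqrt hint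
    _ = Real.sqrt ((2 / a₀ + 2) * (a₁ + τ ^ 2)) * B * ε * sobolevNorm 4 D u₀ := by
      rw [Real.sqrt_mul (by positivity), Real.sqrt_sq (by positivity)]
      ring
    -- The extra `+ 1` in the constant, there to make it positive, is discarded.
    _ ≤ _ := by
      have : 0 ≤ ε * sobolevNorm 4 D u₀ := by positivity
      nlinarith
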